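/- \textbf{Setting.} Let $n,m\ge 1$ with $m\ge n\log n$, let $f_1,\dots,f_m:\mathbb R^d\to\mathbb R$ be differentiable and $f=\frac1m\sum_{i=1}^m f_i$. Assume that, for constants $L_->0$, $L_+\ge 0$, $L_\pm\ge 0$ and $f^*\in\mathbb R$: $f$ is $L_-$-smooth (its gradient is $L_-$-Lipschitz) and $f\ge f^*$; $\frac1m\sum_i\|\nabla f_i(x)-\nabla f_i(y)\|^2\le L_+^2\|x-y\|^2$ and $\frac1m\sum_i\|\nabla f_i(x)-\nabla f_i(y)-(\nabla f(x)-\nabla f(y))\|^2\le L_\pm^2\|x-y\|^2$ for all $x,y$. There are $n$ parallel workers; worker $i$ needs at most $\tau_i\in[0,\infty]$ seconds to compute one gradient $\nabla f_j$, with $\tau_1\le\dots\le\tau_n$; the actual times may vary during the run. The equilibrium time is $t^*(S)=\min_{j\in[n]}\big(\sum_{i=1}^j\frac1{\tau_i}\big)^{-1}(S+j)\in[0,\infty]$ (with $1/0=\infty$, $1/\infty=0$). \textbf{Freya PAGE} with step size $\gamma>0$, batch size $S$, probability $p$ and $K$ iterations starts from $x^0$, computes $g^0=\nabla f(x^0)$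 by ComputeGradient, and for $k=0,\dots,K-1$ sets $x^{k+1}=x^k-\gamma g^k$; with probability $p$ it sets $g^{k+1}=\nabla f(x^{k+1})$, computed by ComputeGradient, and otherwise $g^{k+1}=g^k+b^k$, where $b^k$ is returned by ComputeBatchDifference$(S,x^{k+1},x^k)$. The output $\hat x^K$ is uniform on $\{x^0,\dots,x^{K-1}\}$. ComputeGradient$(x)$: all workers start at the same moment, each with an index drawn independently and uniformly from $[m]$; $M=\emptyset$. Whenever a worker delivers $\nabla f_q(x)$, $q$ is put into $M$ (and $\frac1m\nabla f_q(x)$ is added to the sum if $q\notin M$ before); the call ends when $M=[m]$, otherwise this worker is given a new index drawn uniformly from $[m]\setminus M$. ComputeBatchDifference$(S,x,y)$: all workers start at the same moment, each with an index drawn independently and uniformly from $[m]$. Whenever a worker delivers $\nabla f_q(x)-\nabla f_q(y)$ (two gradient computations), it is added with weight $\frac1S$ and the worker is given a new index drawn uniformly from $[m]$; the call ends after $S$ deliveries. The computation times in these calls do not depend on the sampled indices, so the $S$ delivered indices are i.i.d. uniform on $[m]$. \textbf{Theorem.} There are universal constants $0<c\le C<\infty$ such that the following holds in this setting for all $\varepsilon>0$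 and $x^0\in\mathbb R^d$. Let $\delta^0=f(x^0)-f^*$, $$S=\min\Big\{\max\Big\{\Big\lceil \frac{L_\pm\sqrt m}{L_-}\Big\rceil,1\Big\},m\Big\},\qquad p=\frac Sm,\qquad \gamma=\Big(L_-+L_\pm\sqrt{\tfrac{1-p}{pS}}\Big)^{-1},$$ and let $K$ be the least positive integer with $K\ge\frac{2\delta^0}{\varepsilon}\big(L_-+L_\pm\sqrt{\tfrac{1-p}{pS}}\big)$. Then $K$ iterations of Freya PAGE give $\mathbb E\|\nabla f(\hat x^K)\|^2\le\varepsilon$, and the expected total time is at most $$C\Big(t^*(m)+\frac{\delta^0L_-}{\varepsilon}\,t^*(S)\Big)$$ seconds. This is the exact order in the worst case: if every gradient computation of worker $i$ takes exactly $\tau_i$ seconds, the expected total time is also at least $c\big(t^*(m)+\frac{\delta^0L_-}{\varepsilon}t^*(S)\big)$. -/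

import Mathlib

open scoped NNReal ENNReal

noncomputable section

namespace FreyaPAGE

/-- Expectation of a nonnegative quantity under a discrete distribution. -/
def expect {α : Type*} (P : PMF α) (φ : α → ℝ≥0∞) : ℝ≥0∞ := ∑' a, P a * φ a

/-- The Bernoulli distribution with success probability `p`. -/
def coin (p : ℝ≥0) (hp : p ≤ 1) : PMF Bool :=
  PMF.ofFintype (fun b => cond b (p : ℝ≥0∞) (1 - p)) (by simp [hp])

/-! ### The finite-sum problem -/

section Problem

variable {E : Type*} [NormedAddCommGroup E] [InnerProductSpace ℝ E] [CompleteSpace E] {m : ℕ}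

/-- The objective `f = (1/m) ∑ f_i`. -/
def objective (f : Fin m → E → ℝ) (x : E) : ℝ := (1 / (m : ℝ)) * ∑ i, f i x

/-- `h` is `L`-smooth: differentiable with `L`-Lipschitz gradient. -/
def IsSmoothWith (L : ℝ) (h : E → ℝ) : Prop :=
  Differentiable ℝ h ∧ ∀ x y, ‖gradient h x - gradient h y‖ ≤ L * ‖x - y‖

/-- `(1/m) ∑ ‖∇f_i(x) - ∇f_i(y)‖² ≤ L² ‖x - y‖²`. -/
def MeanSquaredSmooth (L : ℝ) (f : Fin m → E → ℝ) : Prop :=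
  ∀ x y, (1 / (m : ℝ)) * ∑ i, ‖gradient (f i) x - gradient (f i) y‖ ^ 2 ≤ L ^ 2 * ‖x - y‖ ^ 2

/-- Hessian variance:
`(1/m) ∑ ‖∇f_i(x) - ∇f_i(y) - (∇f(x) - ∇f(y))‖² ≤ L² ‖x - y‖²`. -/
def HessianVariance (L : ℝ) (f : Fin m → E → ℝ) : Prop :=
  ∀ x y, (1 / (m : ℝ)) * ∑ i, ‖gradient (f i) x - gradient (f i) y
      - (gradient (objective f) x - gradient (objective f) y)‖ ^ 2 ≤ L ^ 2 * ‖x - y‖ ^ 2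

end Problem

/-! ### The equilibrium time -/

/-- `t*(S, τ) = min_{j ∈ [n]} (∑_{i ≤ j} 1/τ_i)⁻¹ (S + j)`, with `1/0 = ∞` and `1/∞ = 0`.
(`j : Fin n` is counted from zero, whence `j + 1`.) -/
def equilibriumTime {n : ℕ} (S : ℕ) (τ : Fin n → ℝ≥0∞) : ℝ≥0∞ :=
  ⨅ j : Fin n, (∑ i ∈ Finset.Iic j, (τ i)⁻¹)⁻¹ * ((S : ℝ≥0∞) + ((j : ℕ) + 1 : ℕ))

/-! ### Workers -/

/-- `dur i r j` is the time that worker `i` needs for the `r`-th task (`r = 0, 1, …`) it is given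
in the current subroutine call, if the task concerns the data index `j`. -/
abbrev Durations (n m : ℕ) := Fin n → ℕ → Fin m → ℝ≥0∞

/-- The workers during a subroutine call: the index each is working on, the time at which it
will finish, and the number of tasks it has been given in this call. -/
structure Workers (n m : ℕ) where
  task : Fin n → Fin m
  finish : Fin n → ℝ≥0∞
  count : Fin n → ℕ

/-- All workers start their first tasks at time `0` of the call. -/
def Workers.start {n m : ℕ} (dur : Durations n m) (task : Fin n → Fin m) : Workers n m where
  task := task
  finish := fun i => dur i 0 (task i)
  count := fun _ => 1

/-- Worker `i`, which has just finished, is asked to work on index `j`. -/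
def Workers.assign {n m : ℕ} (dur : Durations n m) (w : Workers n m) (i : Fin n) (j : Fin m) :
    Workers n m where
  task := Function.update w.task i j
  finish := Function.update w.finish i (w.finish i + dur i (w.count i) j)
  count := Function.update w.count i (w.count i + 1)

/-- The worker that finishes next. It is selected from the finishing times alone; ties are broken
arbitrarily. -/
def Workers.next {n m : ℕ} [NeZero n] (w : Workers n m) : Fin n :=
  (Finite.exists_min w.finish).choose

/-- The termination measure of the loop of ComputeGradient: with every received gradient, either
`[m] \ M` becomes smaller, or fewer workers work on indices that are already in `M`. -/
theorem gradientLoop_decreasing {n m : ℕ} [NeZero n] (dur : Durations n m) (M : Finset (Fin m))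
    (w : Workers n m) {j : Fin m} (hj : j ∉ insert (w.task w.next) M) :
    Prod.Lex (· < ·) (· < ·)
      ((insert (w.task w.next) M)ᶜ.card, (Finset.univ.filter fun i =>
        (w.assign dur w.next j).task i ∈ insert (w.task w.next) M).card)
      (Mᶜ.card, (Finset.univ.filter fun i => w.task i ∈ M).card) := by
  by_cases hq : w.task w.next ∈ M
  · rw [Finset.insert_eq_of_mem hq] at hj ⊢
    apply Prod.Lex.right
    apply Finset.card_lt_card
    rw [Finset.ssubset_iff_of_subset]
    · refine ⟨w.next, by simpa using hq, fun h => hj ?_⟩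
      simpa [Workers.assign] using (Finset.mem_filter.1 h).2
    · intro k hk
      by_cases hki : k = w.next
      · subst hki
        simpa using hq
      · refine Finset.mem_filter.2 ⟨Finset.mem_univ _, ?_⟩
        simpa [Workers.assign, hki] using (Finset.mem_filter.1 hk).2
  · apply Prod.Lex.left
    apply Finset.card_lt_card
    rw [Finset.compl_ssubset_compl]
    exact Finset.ssubset_insert hq

section Algorithms

variable {E : Type*} [NormedAddCommGroup E] [InnerProductSpace ℝ E] [CompleteSpace E]
variable {n m : ℕ} [NeZero n] [NeZero m]

/-! ### ComputeGradient -/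

/-- The loop `while M ≠ [m]` of ComputeGradient, entered with `M ≠ [m]`: wait for a gradient
`∇f_q(x)` from a worker `i`; if `q ∉ M`, add it to the sum and put `q` into `M`; if now `M = [m]`,
return the sum together with the present time, and otherwise ask worker `i` to work on an index
sampled uniformly from `[m] \ M`. -/
def gradientLoop (f : Fin m → E → ℝ) (x : E) (dur : Durations n m)
    (M : Finset (Fin m)) (g : E) (w : Workers n m) : PMF (E × ℝ≥0∞) :=
  let i := w.next
  let q := w.task i
  let g' := if q ∈ M then g else g + (1 / (m : ℝ)) • gradient (f q) x
  let M' := insert q M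
  if h : M' = Finset.univ then PMF.pure (g', w.finish i)
  else
    haveI : Nonempty {j : Fin m // j ∉ M'} := by
      by_contra hne
      exact h (Finset.eq_univ_iff_forall.2 fun j => by
        by_contra hj
        exact hne ⟨⟨j, hj⟩⟩)
    (PMF.uniformOfFintype {j : Fin m // j ∉ M'}).bind fun j =>
      gradientLoop f x dur M' g' (w.assign dur i j.1)
termination_by (Mᶜ.card, (Finset.univ.filter fun i => w.task i ∈ M).card)
decreasing_by exact gradientLoop_decreasing dur M w j.2

/-- ComputeGradient at the point `x`: returns the computed vector and the time the call took. At
the start, each worker independently gets a uniformly random index. -/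
def computeGradient (f : Fin m → E → ℝ) (x : E) (dur : Durations n m) : PMF (E × ℝ≥0∞) :=
  (PMF.uniformOfFintype (Fin n → Fin m)).bind fun task =>
    gradientLoop f x dur ∅ 0 (Workers.start dur task)

/-! ### ComputeBatchDifference -/

/-- The loop of ComputeBatchDifference with the given number of remaining rounds; `t` is the
present time. -/
def batchLoop (f : Fin m → E → ℝ) (S : ℕ) (x y : E) (dur : Durations n m) :
    ℕ → E → ℝ≥0∞ → Workers n m → PMF (E × ℝ≥0∞)
  | 0, g, t, _ => PMF.pure (g, t)
  | rounds + 1, g, _, w =>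
    let i := w.next
    let q := w.task i
    (PMF.uniformOfFintype (Fin m)).bind fun j =>
      batchLoop f S x y dur rounds (g + (1 / (S : ℝ)) • (gradient (f q) x - gradient (f q) y))
        (w.finish i) (w.assign dur i j)

/-- ComputeBatchDifference: returns the computed vector and the time the call took. -/
def computeBatchDifference (f : Fin m → E → ℝ) (S : ℕ) (x y : E) (dur : Durations n m) :
    PMF (E × ℝ≥0∞) :=
  (PMF.uniformOfFintype (Fin n → Fin m)).bind fun task =>
    batchLoop f S x y dur S 0 0 (Workers.start dur task)

end Algorithms

/-! ### Freya PAGE -/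

/-- State after `k` iterations: the iterates `x 0, …, x k`, the gradient estimator `g`, and the
time elapsed so far. -/
structure State (E : Type*) where
  k : ℕ
  x : ℕ → E
  g : E
  time : ℝ≥0∞

/-- The computation times of the workers. `preproc` is used in the initial ComputeGradient call;
`grad s` in a ComputeGradient call made in the iteration that starts in state `s`; `batch s i r` is
the time worker `i` needs for the `r`-th single gradient it computes in a ComputeBatchDifference
call made in the iteration that starts in state `s`. The times may change during the run and depend
on its past. In ComputeBatchDifference they do not depend on the sampled index, so that the
`S` indices arriving first are i.i.d. uniform on `[m]`, as the method requires. -/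
structure ComputeTimes (E : Type*) (n m : ℕ) where
  preproc : Durations n m
  grad : State E → Durations n m
  batch : State E → Fin n → ℕ → ℝ≥0∞

/-- Worker `i` needs at most `τ i` seconds for every gradient. -/
def ComputeTimes.BoundedBy {E : Type*} {n m : ℕ} (T : ComputeTimes E n m) (τ : Fin n → ℝ≥0∞) :
    Prop :=
  (∀ i r j, T.preproc i r j ≤ τ i) ∧ (∀ s i r j, T.grad s i r j ≤ τ i) ∧
    ∀ s i r, T.batch s i r ≤ τ i

/-- Worker `i` needs exactly `τ i` seconds for every gradient. -/
def ComputeTimes.exact (E : Type*) {n : ℕ} (m : ℕ) (τ : Fin n → ℝ≥0∞) : ComputeTimes E n m where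
  preproc := fun i _ _ => τ i
  grad := fun _ i _ _ => τ i
  batch := fun _ i _ => τ i

/-- A difference `∇f_j(x) - ∇f_j(y)` consists of two gradient computations. -/
def ComputeTimes.diff {E : Type*} {n m : ℕ} (T : ComputeTimes E n m) (s : State E) :
    Durations n m :=
  fun i r _ => T.batch s i (2 * r) + T.batch s i (2 * r + 1)

section Method

variable {E : Type*} [NormedAddCommGroup E] [InnerProductSpace ℝ E] [CompleteSpace E]
variable {n m : ℕ} [NeZero n] [NeZero m]

/-- One iteration of Freya PAGE. -/
def step (f : Fin m → E → ℝ) (T : ComputeTimes E n m) (γ : ℝ) (S : ℕ) (p : ℝ≥0) (hp : p ≤ 1)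
    (s : State E) : PMF (State E) :=
  let xnew := s.x s.k - γ • s.g
  let x' := Function.update s.x (s.k + 1) xnew
  (coin p hp).bind fun c =>
    if c then
      (computeGradient f xnew (T.grad s)).map fun r =>
        { k := s.k + 1, x := x', g := r.1, time := s.time + r.2 }
    else
      (computeBatchDifference f S xnew (s.x s.k) (T.diff s)).map fun r =>
        { k := s.k + 1, x := x', g := s.g + r.1, time := s.time + r.2 }

/-- `K` iterations of Freya PAGE from `x0`, including the preprocessing step. -/
def run (f : Fin m → E → ℝ) (T : ComputeTimes E n m) (γ : ℝ) (S : ℕ) (p : ℝ≥0) (hp : p ≤ 1)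
    (x0 : E) : ℕ → PMF (State E)
  | 0 => (computeGradient f x0 T.preproc).map fun r =>
      { k := 0, x := fun _ => x0, g := r.1, time := r.2 }
  | K + 1 => (run f T γ S p hp x0 K).bind (step f T γ S p hp)

/-- The joint distribution of the output point `x̂`, sampled uniformly at random from
`x 0, …, x (K-1)`, and of the total time of `K` iterations. -/
def freyaPAGE (f : Fin m → E → ℝ) (T : ComputeTimes E n m) (γ : ℝ) (S : ℕ) (p : ℝ≥0) (hp : p ≤ 1)
    (x0 : E) (K : ℕ) (hK : 0 < K) : PMF (E × ℝ≥0∞) :=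
  (run f T γ S p hp x0 K).bind fun s =>
    (PMF.uniformOfFinset (Finset.range K) (Finset.nonempty_range_iff.2 hK.ne')).map fun k =>
      (s.x k, s.time)

end Method

end FreyaPAGE

end

open FreyaPAGE

/-! Write R = δ⁰L₋/ε, b = L±√((1-p)/(pS)). The choice of S gives b ≤ L₋ (`mul_sqrt_le`), so K lies
between 2R and 4R + 1. It remains to prove convergence in K iterations and to bound the expected
time of each call from both sides.

Convergence. ComputeGradient returns the exact gradient (`expect_computeGradient_vector`). The batch
durations ignore the sampled indices, so the delivered indices are independent and uniform, and a
batch adds at most (L±²/S)‖x-y‖² to the mean squared error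
(`expect_computeBatchDifference_norm_sq_le`). With the descent lemma this makes `lyapunov`
nonincreasing in expectation (`expect_step_lyapunov_le`).

Upper time bound. If worker i has been given c_i tasks and the next delivery comes at time t, then t
≤ c_i τ_i. Dividing by τ_i and summing over i ≤ j bounds t by (∑ 1/τ_i)⁻¹ ∑ c_i, so only the number
of assignments matters. A batch makes at most S of them after the start. For ComputeGradient this is
a coupon collector problem in which several workers may hold the same index: `potential` drops by
1/2 on average per reassignment and starts at O(m + n log m), which is O(m) when m ≥ n log n. Since
(S/m) t*(m) ≤ t*(S), an iteration costs O(t*(S)) on average.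

Lower time bound. N deliveries by time t force t*(N) ≤ 2t (`equilibriumTime_le_two_mul`), and the
two calls need at least m and exactly S deliveries. -/

namespace FreyaPAGE

/-! ### Expectations under discrete distributions -/

section Expect

variable {α β : Type*}

theorem expect_pure (a : α) (φ : α → ℝ≥0∞) : expect (PMF.pure a) φ = φ a := by
  rw [expect, tsum_eq_single a]
  · simp
  · intro b hb
    simp [PMF.pure_apply, hb]

theorem expect_bind (P : PMF α) (Q : α → PMF β) (φ : β → ℝ≥0∞) :
    expect (P.bind Q) φ = expect P fun a => expect (Q a) φ := by
  simp only [expect, PMF.bind_apply, ← ENNReal.tsum_mul_left, ← ENNReal.tsum_mul_right]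
  rw [ENNReal.tsum_comm]
  simp only [mul_assoc]

theorem expect_map (P : PMF α) (h : α → β) (φ : β → ℝ≥0∞) :
    expect (P.map h) φ = expect P (φ ∘ h) := by
  rw [PMF.map, expect_bind]
  simp [expect_pure, Function.comp_def]

theorem expect_mono (P : PMF α) {φ ψ : α → ℝ≥0∞} (h : ∀ a, φ a ≤ ψ a) :
    expect P φ ≤ expect P ψ :=
  ENNReal.tsum_le_tsum fun a => mul_le_mul_right (h a) _

theorem expect_congr_support (P : PMF α) {φ ψ : α → ℝ≥0∞} (h : ∀ a ∈ P.support, φ a = ψ a) :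
    expect P φ = expect P ψ := by
  refine tsum_congr fun a => ?_
  by_cases ha : P a = 0
  · simp [ha]
  · rw [h a ((P.mem_support_iff a).2 ha)]

theorem expect_const (P : PMF α) (c : ℝ≥0∞) : expect P (fun _ => c) = c := by
  rw [expect, ENNReal.tsum_mul_right, P.tsum_coe, one_mul]

theorem expect_le_of_le (P : PMF α) {φ : α → ℝ≥0∞} {c : ℝ≥0∞} (h : ∀ a, φ a ≤ c) :
    expect P φ ≤ c :=
  (expect_mono P h).trans_eq (expect_const P c)

theorem le_expect_of_le (P : PMF α) {φ : α → ℝ≥0∞} {c : ℝ≥0∞} (h : ∀ a, c ≤ φ a) :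
    c ≤ expect P φ :=
  (expect_const P c).symm.trans_le (expect_mono P h)

theorem expect_add (P : PMF α) (φ ψ : α → ℝ≥0∞) :
    expect P (fun a => φ a + ψ a) = expect P φ + expect P ψ := by
  simp only [expect, mul_add, ENNReal.tsum_add]

theorem expect_const_mul (P : PMF α) (c : ℝ≥0∞) (φ : α → ℝ≥0∞) :
    expect P (fun a => c * φ a) = c * expect P φ := by
  simp only [expect, ← ENNReal.tsum_mul_left, mul_left_comm]

theorem expect_uniformOfFintype [Fintype α] [Nonempty α] (φ : α → ℝ≥0∞) :
    expect (PMF.uniformOfFintype α) φ = (Fintype.card α : ℝ≥0∞)⁻¹ * ∑ a, φ a := by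
  simp only [expect, PMF.uniformOfFintype_apply, tsum_fintype, Finset.mul_sum]

theorem expect_uniformOfFinset (s : Finset α) (hs : s.Nonempty) (φ : α → ℝ≥0∞) :
    expect (PMF.uniformOfFinset s hs) φ = (s.card : ℝ≥0∞)⁻¹ * ∑ a ∈ s, φ a := by
  rw [expect, tsum_eq_sum (s := s), Finset.mul_sum]
  · exact Finset.sum_congr rfl fun a ha => by rw [PMF.uniformOfFinset_apply, if_pos ha]
  · intro a ha
    rw [PMF.uniformOfFinset_apply, if_neg ha, zero_mul]

theorem expect_coin (p : ℝ≥0) (hp : p ≤ 1) (φ : Bool → ℝ≥0∞) :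
    expect (coin p hp) φ = p * φ true + (1 - p) * φ false := by
  simp [expect, coin, tsum_fintype]

end Expect

/-! ### Unfolding one round of the loops -/

section Loops

variable {E : Type*} [NormedAddCommGroup E] [InnerProductSpace ℝ E] [CompleteSpace E]
variable {n m : ℕ} [NeZero n] (f : Fin m → E → ℝ) (x : E) (dur : Durations n m)

theorem expect_gradientLoop_of_eq_univ {M : Finset (Fin m)} {w : Workers n m} (g : E)
    (h : insert (w.task w.next) M = Finset.univ) (φ : E × ℝ≥0∞ → ℝ≥0∞) :
    expect (gradientLoop f x dur M g w) φ =
      φ (if w.task w.next ∈ M then g else g + (1 / (m : ℝ)) • gradient (f (w.task w.next)) x,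
        w.finish w.next) := by
  rw [gradientLoop, dif_pos h, expect_pure]

theorem expect_gradientLoop_of_ne_univ {M : Finset (Fin m)} {w : Workers n m} (g : E)
    (h : insert (w.task w.next) M ≠ Finset.univ) (φ : E × ℝ≥0∞ → ℝ≥0∞) :
    expect (gradientLoop f x dur M g w) φ =
      ((insert (w.task w.next) M)ᶜ.card : ℝ≥0∞)⁻¹ * ∑ j ∈ (insert (w.task w.next) M)ᶜ,
        expect (gradientLoop f x dur (insert (w.task w.next) M)
          (if w.task w.next ∈ M then g else g + (1 / (m : ℝ)) • gradient (f (w.task w.next)) x)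
          (w.assign dur w.next j)) φ := by
  obtain ⟨k, hk⟩ : ∃ k, k ∉ insert (w.task w.next) M := by
    simpa [Finset.eq_univ_iff_forall] using h
  have : Nonempty {j : Fin m // j ∉ insert (w.task w.next) M} := ⟨⟨k, hk⟩⟩
  rw [gradientLoop, dif_neg h, expect_bind, expect_uniformOfFintype]
  congr 1
  · rw [Fintype.card_subtype]
    congr 3
    ext j
    simp
  · exact (Finset.sum_subtype _ (by simp) fun j =>
      expect (gradientLoop f x dur (insert (w.task w.next) M)
        (if w.task w.next ∈ M then g else g + (1 / (m : ℝ)) • gradient (f (w.task w.next)) x)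
        (w.assign dur w.next j)) φ).symm

/-- Induction along the loop of ComputeGradient. -/
theorem gradientLoop_induction {motive : Finset (Fin m) → Workers n m → Prop}
    (h : ∀ M w, (∀ j ∈ (insert (w.task w.next) M)ᶜ,
      motive (insert (w.task w.next) M) (w.assign dur w.next j)) → motive M w)
    (M : Finset (Fin m)) (w : Workers n m) : motive M w :=
  h M w fun j _hj =>
    gradientLoop_induction h (insert (w.task w.next) M) (w.assign dur w.next j)
termination_by (Mᶜ.card, (Finset.univ.filter fun i => w.task i ∈ M).card)
decreasing_by exact gradientLoop_decreasing dur M w (Finset.mem_compl.1 _hj)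

theorem expect_batchLoop_zero (S : ℕ) (y : E) (g : E) (t : ℝ≥0∞) (w : Workers n m) [NeZero m]
    (φ : E × ℝ≥0∞ → ℝ≥0∞) : expect (batchLoop f S x y dur 0 g t w) φ = φ (g, t) := by
  rw [batchLoop, expect_pure]

theorem expect_batchLoop_succ [NeZero m] (S : ℕ) (y : E) (rounds : ℕ) (g : E) (t : ℝ≥0∞)
    (w : Workers n m) (φ : E × ℝ≥0∞ → ℝ≥0∞) :
    expect (batchLoop f S x y dur (rounds + 1) g t w) φ =
      expect (PMF.uniformOfFintype (Fin m)) fun j =>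
        expect (batchLoop f S x y dur rounds (g + (1 / (S : ℝ)) •
          (gradient (f (w.task w.next)) x - gradient (f (w.task w.next)) y))
          (w.finish w.next) (w.assign dur w.next j)) φ := by
  rw [batchLoop, expect_bind]

end Loops

theorem Workers.finish_next_le {n m : ℕ} [NeZero n] (w : Workers n m) (i : Fin n) :
    w.finish w.next ≤ w.finish i :=
  (Finite.exists_min w.finish).choose_spec i

/-! ### A potential for the number of rounds of ComputeGradient -/

section Potential

variable {n m : ℕ}

/-- The number of workers that work on the index `q`. -/
def load (task : Fin n → Fin m) (q : Fin m) : ℕ := (Finset.univ.filter fun i => task i = q).card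

/-- With `r` missing indices, at least half of them have a load below `loadCap n r`. -/
def loadCap (n r : ℕ) : ℕ := 2 * n / r + 1

/-- The cost of the growth of `loadCap` while the number of missing indices decreases from `R`. -/
def capGrowth (n R : ℕ) : ℕ := ∑ r ∈ Finset.range R, r * (loadCap n r - loadCap n (r + 1))

/-- The potential: it decreases by at least `1 / 2` on average whenever a worker gets a uniformly
random missing index, and it does not increase when an index ceases to be missing. -/
def potential (M : Finset (Fin m)) (task : Fin n → Fin m) : ℕ :=
  ∑ q ∈ Mᶜ, (loadCap n Mᶜ.card - load task q) + capGrowth n Mᶜ.card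

/-- When the number of missing indices falls from R + 1 to R, the cap rises for each of the R
remaining ones. The last term of `capGrowth n (R + 1)` is exactly what pays for this. -/
theorem potential_insert_le (M : Finset (Fin m)) (task : Fin n → Fin m) (q : Fin m) :
    potential (insert q M) task ≤ potential M task := by
  by_cases hq : q ∈ M
  · rw [Finset.insert_eq_of_mem hq]
  have hq' : q ∈ Mᶜ := Finset.mem_compl.2 hq
  have hcard := Finset.card_erase_add_one hq'
  rw [potential, potential, Finset.compl_insert]
  set U := Mᶜ
  set R := (U.erase q).card
  rw [← hcard, ← Finset.sum_erase_add _ _ hq', capGrowth, capGrowth, Finset.sum_range_succ]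
  have h : ∑ k ∈ U.erase q, (loadCap n R - load task k) ≤
      ∑ k ∈ U.erase q, (loadCap n (R + 1) - load task k) +
        R * (loadCap n R - loadCap n (R + 1)) := by
    rw [← smul_eq_mul, ← Finset.sum_const, ← Finset.sum_add_distrib]
    exact Finset.sum_le_sum fun k _ => by omega
  omega

theorem sum_load_le (U : Finset (Fin m)) (task : Fin n → Fin m) : ∑ q ∈ U, load task q ≤ n := by
  calc ∑ q ∈ U, load task q ≤ ∑ q, load task q :=
        Finset.sum_le_sum_of_subset (Finset.subset_univ U)
    _ = n := by
        simp only [load]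
        rw [← Finset.card_eq_sum_card_fiberwise (fun i _ => Finset.mem_coe.2 (Finset.mem_univ _))]
        simp

/-- Markov's inequality: the loads sum to at most n, while the cap exceeds 2n / |U|, so fewer than
half of the indices in a nonempty U can reach the cap. -/
theorem card_le_two_mul_card_load_lt (U : Finset (Fin m)) (task : Fin n → Fin m) :
    U.card ≤ 2 * (U.filter fun q => load task q < loadCap n U.card).card := by
  rcases U.eq_empty_or_nonempty with rfl | hU
  · simp
  have hsplit := Finset.card_filter_add_card_filter_not (s := U)
    (fun q => load task q < loadCap n U.card)
  set b := (U.filter fun q => ¬ load task q < loadCap n U.card).card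
  have hb : b * loadCap n U.card ≤ n := by
    refine le_trans ?_ (sum_load_le U task)
    rw [← smul_eq_mul, ← Finset.sum_const]
    refine le_trans (Finset.sum_le_sum fun q hq => ?_)
      (Finset.sum_le_sum_of_subset (Finset.filter_subset _ U))
    exact not_lt.1 (Finset.mem_filter.1 hq).2
  have hcap : 2 * n < U.card * loadCap n U.card := Nat.lt_mul_div_succ _ hU.card_pos
  have : 2 * b < U.card := by
    by_contra! h
    have := Nat.mul_le_mul_right (loadCap n U.card) h
    rw [mul_assoc] at this
    omega
  omega

theorem load_update (task : Fin n → Fin m) (i : Fin n) (j q : Fin m) (hq : q ≠ task i) :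
    load (Function.update task i j) q = load task q + if q = j then 1 else 0 := by
  have hi : i ∉ Finset.univ.filter fun k => task k = q := by simpa using hq.symm
  split_ifs with h
  · subst h
    rw [load, load, ← Finset.card_insert_of_notMem hi]
    congr 1
    ext k
    by_cases hk : k = i <;> simp [hk]
  · rw [load, load, add_zero]
    congr 1
    ext k
    by_cases hk : k = i
    · simp [hk, hq.symm, Ne.symm h]
    · simp [hk]

/-- The worker leaves an index that is no longer missing, so no summand grows. The summand of j
loses one unless truncated subtraction has already made it zero. -/
theorem potential_update_add_le (M : Finset (Fin m)) (task : Fin n → Fin m) (i : Fin n)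
    (hi : task i ∈ M) {j : Fin m} (hj : j ∈ Mᶜ) :
    potential M (Function.update task i j) + (if load task j < loadCap n Mᶜ.card then 1 else 0) ≤
      potential M task := by
  have hne : ∀ q ∈ Mᶜ, q ≠ task i := by
    rintro q hq rfl
    exact Finset.mem_compl.1 hq hi
  rw [potential, potential, ← Finset.sum_erase_add _ _ hj, ← Finset.sum_erase_add _ _ hj,
    load_update task i j j (hne j hj), if_pos rfl]
  have h : ∑ k ∈ Mᶜ.erase j, (loadCap n Mᶜ.card - load (Function.update task i j) k) =
      ∑ k ∈ Mᶜ.erase j, (loadCap n Mᶜ.card - load task k) := by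
    refine Finset.sum_congr rfl fun k hk => ?_
    rw [load_update task i j k (hne k (Finset.mem_of_mem_erase hk)),
      if_neg (Finset.ne_of_mem_erase hk), add_zero]
  rw [h]
  split_ifs <;> omega

/-- The average drop of 1/2, doubled to stay in ℕ: at least half of the possible j have room below
the cap, and each of these lowers the potential by one. -/
theorem sum_potential_update_le (M : Finset (Fin m)) (task : Fin n → Fin m) (i : Fin n)
    (hi : task i ∈ M) :
    ∑ j ∈ Mᶜ, (2 * potential M (Function.update task i j) + 1) ≤
      Mᶜ.card * (2 * potential M task) := by
  have h := Finset.sum_le_sum fun j hj => potential_update_add_le M task i hi (j := j) hj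
  rw [Finset.sum_add_distrib, Finset.sum_const, smul_eq_mul, ← Finset.card_filter] at h
  have h' := card_le_two_mul_card_load_lt Mᶜ task
  rw [Finset.sum_add_distrib, Finset.sum_const, smul_eq_mul, mul_one, ← Finset.mul_sum]
  nlinarith

/-- Summation by parts. It turns the initial potential into a harmonic sum. -/
theorem mul_loadCap_add_capGrowth (n R : ℕ) :
    R * loadCap n R + capGrowth n R = ∑ r ∈ Finset.range R, loadCap n (r + 1) := by
  induction R with
  | zero => simp [capGrowth]
  | succ R ih =>
    rw [Finset.sum_range_succ, ← ih, capGrowth, capGrowth, Finset.sum_range_succ]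
    -- Division by zero gives `loadCap n 0 = 1`, so monotonicity of the cap may fail at R = 0; there
    -- the difference carries the factor 0.
    rcases R.eq_zero_or_pos with rfl | hR
    · simp
    have h : loadCap n (R + 1) ≤ loadCap n R :=
      Nat.add_le_add_right (Nat.div_le_div_left (Nat.le_succ R) hR) 1
    obtain ⟨a, ha⟩ := Nat.exists_eq_add_of_le h
    rw [ha, Nat.add_sub_cancel_left]
    ring

theorem potential_empty_le (task : Fin n → Fin m) :
    (potential ∅ task : ℝ) ≤ m + 2 * n * (1 + Real.log m) := by
  have h1 : potential ∅ task ≤ ∑ r ∈ Finset.range m, loadCap n (r + 1) := by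
    rw [← mul_loadCap_add_capGrowth, potential, Finset.compl_empty, Finset.card_univ,
      Fintype.card_fin]
    refine Nat.add_le_add_right ?_ _
    calc ∑ q, (loadCap n m - load task q) ≤ ∑ _q : Fin m, loadCap n m :=
          Finset.sum_le_sum fun q _ => Nat.sub_le _ _
      _ = m * loadCap n m := by simp
  have h2 : ((∑ r ∈ Finset.range m, loadCap n (r + 1) : ℕ) : ℝ) ≤
      m + 2 * n * (harmonic m : ℝ) := by
    rw [harmonic, Rat.cast_sum, Finset.mul_sum, Nat.cast_sum]
    have : (m : ℝ) = ∑ _r ∈ Finset.range m, (1 : ℝ) := by simp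
    conv_rhs => rw [this]
    rw [← Finset.sum_add_distrib]
    refine Finset.sum_le_sum fun r _ => ?_
    have := Nat.cast_div_le (m := 2 * n) (n := r + 1) (α := ℝ)
    rw [loadCap]
    push_cast at this ⊢
    rw [div_eq_mul_inv] at this
    linarith
  have h3 := harmonic_le_one_add_log m
  have h4 : (0 : ℝ) ≤ 2 * n := by positivity
  calc (potential ∅ task : ℝ) ≤ _ := by exact_mod_cast h1
    _ ≤ _ := h2
    _ ≤ _ := by gcongr

/-- If n² ≤ m, then n ≤ √m and log m ≤ 2√m suffice. Otherwise log m ≤ 2 log n, and n ≥ 2 gives n ≤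
2n log n, so both summands are at most 2m. -/
theorem mul_one_add_log_le (hn : 0 < n) (hm : 0 < m) (h : (n : ℝ) * Real.log n ≤ m) :
    (n : ℝ) * (1 + Real.log m) ≤ 4 * m := by
  have hn' : (1 : ℝ) ≤ n := by exact_mod_cast hn
  have hm' : (1 : ℝ) ≤ m := by exact_mod_cast hm
  by_cases hc : (n : ℝ) ^ 2 ≤ m
  · have hs : (n : ℝ) ≤ √(m : ℝ) := Real.le_sqrt_of_sq_le hc
    have hlog : Real.log m ≤ 2 * √(m : ℝ) := by
      have h1 := Real.log_le_self (Real.sqrt_nonneg (m : ℝ))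
      rw [Real.log_sqrt (by positivity)] at h1
      linarith
    have hsq := Real.mul_self_sqrt (Nat.cast_nonneg (α := ℝ) m)
    have h0 := Real.sqrt_nonneg (m : ℝ)
    nlinarith [mul_le_mul hs hlog (Real.log_nonneg hm') h0]
  · push Not at hc
    have hn2 : 2 ≤ n := by
      by_contra! h1
      have : n = 1 := by omega
      subst this
      norm_num at hc
      linarith
    have hlog : Real.log m ≤ 2 * Real.log n := by
      rw [← Nat.cast_two, ← Real.log_pow]
      exact Real.log_le_log (by linarith) (by exact_mod_cast hc.le)
    have h2 : (1 : ℝ) / 2 ≤ Real.log n := by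
      have := Real.log_two_gt_d9
      have := Real.log_le_log two_pos (show (2 : ℝ) ≤ n by exact_mod_cast hn2)
      linarith
    nlinarith

theorem two_mul_potential_empty_le (hn : 0 < n) (hm : 0 < m)
    (h : (n : ℝ) * Real.log n ≤ m) (task : Fin n → Fin m) : 2 * potential ∅ task ≤ 18 * m := by
  have h1 := potential_empty_le task
  have h2 := mul_one_add_log_le hn hm h
  have : (2 * potential ∅ task : ℝ) ≤ 18 * m := by linarith
  exact_mod_cast this

end Potential

/-! ### Upper bounds for the times of the subroutines -/

section UpperBounds

variable {n m : ℕ}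

/-- Sum t / τ_i ≤ c_i over i ≤ j. Nonzero counts matter when all these τ_i are `⊤`: the first factor
is then `⊤`, and `⊤ * 0` would be 0. -/
theorem le_inv_sum_inv_mul {τ : Fin n → ℝ≥0∞} {c : Fin n → ℕ} {t : ℝ≥0∞} (hc : ∀ i, c i ≠ 0)
    (h : ∀ i, t ≤ c i * τ i) (j : Fin n) :
    t ≤ (∑ i ∈ Finset.Iic j, (τ i)⁻¹)⁻¹ * ((∑ i ∈ Finset.Iic j, c i : ℕ) : ℝ≥0∞) := by
  have hpos : ((∑ i ∈ Finset.Iic j, c i : ℕ) : ℝ≥0∞) ≠ 0 := by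
    rw [Nat.cast_ne_zero]
    exact fun h0 => hc j (Finset.sum_eq_zero_iff.1 h0 j (Finset.mem_Iic.2 le_rfl))
  rw [mul_comm, ← div_eq_mul_inv,
    ENNReal.le_div_iff_mul_le (Or.inr hpos) (Or.inr (ENNReal.natCast_ne_top _)),
    Finset.mul_sum, Nat.cast_sum]
  exact Finset.sum_le_sum fun i _ => by
    rw [← div_eq_mul_inv]
    exact ENNReal.div_le_of_le_mul (h i)

theorem Workers.sum_count_assign_le (dur : Durations n m) (w : Workers n m) (i : Fin n) (k : Fin m)
    (s : Finset (Fin n)) : ∑ l ∈ s, (w.assign dur i k).count l ≤ ∑ l ∈ s, w.count l + 1 := by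
  calc ∑ l ∈ s, (w.assign dur i k).count l
      ≤ ∑ l ∈ s, (w.count l + if l = i then 1 else 0) := by
        refine Finset.sum_le_sum fun l _ => ?_
        by_cases hl : l = i
        · subst hl
          simp [Workers.assign]
        · simp [Workers.assign, hl]
    _ ≤ _ := by
        rw [Finset.sum_add_distrib, Finset.sum_ite_eq']
        split_ifs <;> omega

/-- Every worker has been given a task, and worker `i` has needed at most `τ i` per task. -/
def Workers.WithinBounds (w : Workers n m) (τ : Fin n → ℝ≥0∞) : Prop :=
  ∀ i, w.count i ≠ 0 ∧ w.finish i ≤ w.count i * τ i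

theorem Workers.WithinBounds.assign {dur : Durations n m} {τ : Fin n → ℝ≥0∞}
    (hdur : ∀ i r j, dur i r j ≤ τ i) {w : Workers n m} (hw : w.WithinBounds τ) (i : Fin n)
    (k : Fin m) : (w.assign dur i k).WithinBounds τ := by
  intro l
  by_cases hl : l = i
  · subst hl
    simp only [Workers.assign, Function.update_self, Nat.cast_add, Nat.cast_one, add_mul, one_mul]
    exact ⟨Nat.succ_ne_zero _, add_le_add (hw l).2 (hdur _ _ _)⟩
  · simpa [Workers.assign, hl] using hw l

theorem Workers.withinBounds_start {dur : Durations n m} {τ : Fin n → ℝ≥0∞}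
    (hdur : ∀ i r j, dur i r j ≤ τ i) (task : Fin n → Fin m) :
    (Workers.start dur task).WithinBounds τ := fun i => by
  simpa [Workers.start] using hdur i 0 (task i)

theorem Workers.WithinBounds.finish_next_le [NeZero n] {τ : Fin n → ℝ≥0∞} {w : Workers n m}
    (hw : w.WithinBounds τ) (j : Fin n) :
    w.finish w.next ≤
      (∑ i ∈ Finset.Iic j, (τ i)⁻¹)⁻¹ * ((∑ i ∈ Finset.Iic j, w.count i : ℕ) : ℝ≥0∞) :=
  le_inv_sum_inv_mul (fun i => (hw i).1) (fun i => (w.finish_next_le i).trans (hw i).2) j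

theorem sum_Iic_one (j : Fin n) : ∑ _i ∈ Finset.Iic j, 1 = (j : ℕ) + 1 := by
  simp

variable {E : Type*} [NormedAddCommGroup E] [InnerProductSpace ℝ E] [CompleteSpace E]
variable [NeZero n] (f : Fin m → E → ℝ)

/-- Each reassignment adds at most one to the count of the first workers and on average takes at
least one from twice the potential. So the right-hand side does not increase in expectation, and at
termination it dominates the finishing time. -/
theorem expect_gradientLoop_time_le (x : E) {dur : Durations n m} {τ : Fin n → ℝ≥0∞}
    (hdur : ∀ i r j, dur i r j ≤ τ i) (j : Fin n) (M : Finset (Fin m)) (g : E) (w : Workers n m)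
    (hw : w.WithinBounds τ) :
    expect (gradientLoop f x dur M g w) (fun r => r.2) ≤ (∑ i ∈ Finset.Iic j, (τ i)⁻¹)⁻¹ *
      ((∑ i ∈ Finset.Iic j, w.count i + 2 * potential M w.task : ℕ) : ℝ≥0∞) := by
  induction M, w using gradientLoop_induction dur generalizing g with | h M w ih =>
  by_cases h : insert (w.task w.next) M = Finset.univ
  · rw [expect_gradientLoop_of_eq_univ f x dur g h]
    refine (hw.finish_next_le j).trans ?_
    gcongr
    exact Nat.le_add_right _ _
  · rw [expect_gradientLoop_of_ne_univ f x dur g h]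
    set M' := insert (w.task w.next) M with hM'
    set A := (∑ i ∈ Finset.Iic j, (τ i)⁻¹)⁻¹
    set N := ∑ i ∈ Finset.Iic j, w.count i
    have hcard : M'ᶜ.card ≠ 0 := by
      rw [Finset.card_ne_zero, Finset.nonempty_iff_ne_empty, Ne, Finset.compl_eq_empty_iff]
      exact h
    have hterm : ∀ k ∈ M'ᶜ, expect (gradientLoop f x dur M' (if w.task w.next ∈ M then g
          else g + (1 / (m : ℝ)) • gradient (f (w.task w.next)) x) (w.assign dur w.next k))
          (fun r => r.2) ≤
        A * ((N + (2 * potential M' (Function.update w.task w.next k) + 1) : ℕ) : ℝ≥0∞) := by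
      intro k hk
      refine (ih k hk _ (hw.assign hdur _ _)).trans
        (mul_le_mul_right (Nat.cast_le.2 ?_) _)
      have h1 := w.sum_count_assign_le dur w.next k (Finset.Iic j)
      have h2 : (w.assign dur w.next k).task = Function.update w.task w.next k := rfl
      rw [h2]
      omega
    have hpot := sum_potential_update_le M' w.task w.next (by simp [hM'])
    have hins := potential_insert_le M w.task (w.task w.next)
    calc _ ≤ (M'ᶜ.card : ℝ≥0∞)⁻¹ * ∑ k ∈ M'ᶜ,
          A * ((N + (2 * potential M' (Function.update w.task w.next k) + 1) : ℕ) : ℝ≥0∞) := by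
          gcongr with k hk
          exact hterm k hk
      _ = (M'ᶜ.card : ℝ≥0∞)⁻¹ * (A * ((M'ᶜ.card * N + ∑ k ∈ M'ᶜ,
          (2 * potential M' (Function.update w.task w.next k) + 1) : ℕ) : ℝ≥0∞)) := by
          rw [← Finset.mul_sum, ← Nat.cast_sum, Finset.sum_add_distrib (f := fun _ => N),
            Finset.sum_const, smul_eq_mul]
      _ ≤ (M'ᶜ.card : ℝ≥0∞)⁻¹ *
          (A * ((M'ᶜ.card * (N + 2 * potential M w.task) : ℕ) : ℝ≥0∞)) := by
          gcongr
          rw [mul_add]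
          refine Nat.add_le_add_left (hpot.trans ?_) _
          gcongr
      _ = A * ((N + 2 * potential M w.task : ℕ) : ℝ≥0∞) := by
          rw [Nat.cast_mul, mul_left_comm A, ← mul_assoc, ENNReal.inv_mul_cancel
            (Nat.cast_ne_zero.2 hcard) (ENNReal.natCast_ne_top _), one_mul]

theorem expect_computeGradient_time_le [NeZero m] (hnm : (n : ℝ) * Real.log n ≤ m) (x : E)
    {dur : Durations n m} {τ : Fin n → ℝ≥0∞} (hdur : ∀ i r j, dur i r j ≤ τ i) :
    expect (computeGradient f x dur) (fun r => r.2) ≤ 18 * equilibriumTime m τ := by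
  rw [computeGradient, expect_bind]
  refine expect_le_of_le _ fun task => ?_
  rw [equilibriumTime, ENNReal.mul_iInf_of_ne (by norm_num) (by norm_num)]
  refine le_iInf fun j => (expect_gradientLoop_time_le f x hdur j ∅ 0 _
    (Workers.withinBounds_start hdur task)).trans ?_
  rw [mul_left_comm]
  gcongr
  have h := two_mul_potential_empty_le (NeZero.pos n) (NeZero.pos m) hnm task
  have h1 : ∑ i ∈ Finset.Iic j, (Workers.start dur task).count i = (j : ℕ) + 1 := sum_Iic_one j
  have h2 : (Workers.start dur task).task = task := rfl
  rw [h1, h2]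
  norm_cast
  omega

/-- The task assigned after the last delivery cannot delay the call, so `rounds + 1` deliveries cost
only `rounds` further assignments. -/
theorem expect_batchLoop_time_le [NeZero m] (S : ℕ) (x y : E) {dur : Durations n m}
    {τ : Fin n → ℝ≥0∞} (hdur : ∀ i r j, dur i r j ≤ τ i) (j : Fin n) (rounds : ℕ) (g : E)
    (t : ℝ≥0∞) (w : Workers n m) (hw : w.WithinBounds τ) :
    expect (batchLoop f S x y dur (rounds + 1) g t w) (fun r => r.2) ≤
      (∑ i ∈ Finset.Iic j, (τ i)⁻¹)⁻¹ *
        ((∑ i ∈ Finset.Iic j, w.count i + rounds : ℕ) : ℝ≥0∞) := by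
  induction rounds generalizing g t w with
  | zero =>
    rw [expect_batchLoop_succ]
    refine expect_le_of_le _ fun k => ?_
    rw [expect_batchLoop_zero]
    exact hw.finish_next_le j
  | succ rounds ih =>
    rw [expect_batchLoop_succ]
    refine expect_le_of_le _ fun k => (ih _ _ _ (hw.assign hdur _ _)).trans
      (mul_le_mul_right (Nat.cast_le.2 ?_) _)
    have := w.sum_count_assign_le dur w.next k (Finset.Iic j)
    omega

theorem expect_computeBatchDifference_time_le [NeZero m] {S : ℕ} (hS : 0 < S) (x y : E)
    {dur : Durations n m} {τ : Fin n → ℝ≥0∞} (hdur : ∀ i r j, dur i r j ≤ τ i) :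
    expect (computeBatchDifference f S x y dur) (fun r => r.2) ≤ equilibriumTime S τ := by
  rw [computeBatchDifference, expect_bind]
  refine expect_le_of_le _ fun task => le_iInf fun j => ?_
  obtain ⟨R, rfl⟩ := Nat.exists_eq_succ_of_ne_zero hS.ne'
  refine (expect_batchLoop_time_le f _ x y hdur j R 0 0 _
    (Workers.withinBounds_start hdur task)).trans ?_
  gcongr
  have h1 : ∑ i ∈ Finset.Iic j, (Workers.start dur task).count i = (j : ℕ) + 1 := sum_Iic_one j
  rw [h1]
  norm_cast
  omega

end UpperBounds

/-! ### The equilibrium time -/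

section Equilibrium

variable {n : ℕ}

theorem equilibriumTime_mono {S S' : ℕ} (h : S ≤ S') (τ : Fin n → ℝ≥0∞) :
    equilibriumTime S τ ≤ equilibriumTime S' τ := by
  unfold equilibriumTime
  gcongr

theorem equilibriumTime_const_mul [NeZero n] {a : ℝ≥0∞} (h0 : a ≠ 0) (ha : a ≠ ⊤) (S : ℕ)
    (τ : Fin n → ℝ≥0∞) :
    equilibriumTime S (fun i => a * τ i) = a * equilibriumTime S τ := by
  rw [equilibriumTime, equilibriumTime, ENNReal.mul_iInf_of_ne h0 ha]
  refine iInf_congr fun j => ?_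
  rw [← mul_assoc]
  congr 1
  rw [Finset.sum_congr rfl fun i _ => ENNReal.mul_inv (Or.inl h0) (Or.inl ha), ← Finset.mul_sum,
    ENNReal.mul_inv (Or.inl (ENNReal.inv_ne_zero.2 ha)) (Or.inl (ENNReal.inv_ne_top.2 h0)), inv_inv]

/-- Termwise, (S/m)(m + j) ≤ S + j. This is why a full gradient taken with probability S/m costs no
more, in order, than a batch. -/
theorem div_mul_equilibriumTime_le {S m : ℕ} (hm : 0 < m) (h : S ≤ m) (τ : Fin n → ℝ≥0∞) :
    (S : ℝ≥0∞) / m * equilibriumTime m τ ≤ equilibriumTime S τ := by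
  have hm0 : (m : ℝ≥0∞) ≠ 0 := Nat.cast_ne_zero.2 hm.ne'
  refine le_iInf fun j => (mul_le_mul_right (iInf_le _ j) _).trans ?_
  rw [mul_left_comm]
  gcongr
  rw [mul_add, ENNReal.div_mul_cancel hm0 (ENNReal.natCast_ne_top _)]
  gcongr
  refine mul_le_of_le_one_left zero_le (ENNReal.div_le_of_le_mul ?_)
  rw [one_mul]
  exact_mod_cast h

/-- If worker `i` has completed `d i` tasks of length `τ i` by the time `t`, and `S > 0` tasks have
been completed in total, then `t` is at least half of the equilibrium time. -/
theorem equilibriumTime_le_two_mul {τ : Fin n → ℝ≥0∞} (hτ : Monotone τ) {S : ℕ} (hS : 0 < S)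
    {d : Fin n → ℕ} {t : ℝ≥0∞} (hd : ∀ i, d i * τ i ≤ t) (hsum : S ≤ ∑ i, d i) :
    equilibriumTime S τ ≤ 2 * t := by
  rcases eq_or_ne t ⊤ with rfl | ht
  · simp
  have hle : ∀ i, d i ≠ 0 → τ i ≤ t := fun i hi =>
    le_trans (le_mul_of_one_le_left zero_le
      (by exact_mod_cast Nat.one_le_iff_ne_zero.2 hi)) (hd i)
  obtain ⟨i₀, -, hi₀⟩ : ∃ i ∈ Finset.univ, d i ≠ 0 :=
    Finset.exists_ne_zero_of_sum_ne_zero (by omega : ∑ i, d i ≠ 0)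
  -- Take j to be the last worker able to finish one task by time t. Later workers have completed
  -- nothing, so ∑_{i ≤ j} t/τ_i is at least S; each of its terms is at least 1, so it is also at
  -- least the number of these workers.
  obtain ⟨j, hj, hjmax⟩ := (Finset.univ.filter fun i => τ i ≤ t).exists_max_image id
    ⟨i₀, by simpa using hle i₀ hi₀⟩
  have hj : τ j ≤ t := by simpa using hj
  have hIic : ∀ i ∉ Finset.Iic j, d i = 0 := by
    intro i hi
    by_contra h
    exact hi (Finset.mem_Iic.2 (hjmax i (by simpa using hle i h)))
  refine (iInf_le _ j).trans ?_
  by_cases h0 : ∃ i ∈ Finset.Iic j, τ i = 0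
  · obtain ⟨i, hi, h0⟩ := h0
    have : ∑ i ∈ Finset.Iic j, (τ i)⁻¹ = ⊤ := ENNReal.sum_eq_top.2 ⟨i, hi, by simp [h0]⟩
    simp [this]
  push Not at h0
  have hτt : ∀ i ∈ Finset.Iic j, τ i ≤ t := fun i hi => (hτ (Finset.mem_Iic.1 hi)).trans hj
  have hfin : ∀ i ∈ Finset.Iic j, τ i ≠ ⊤ := fun i hi => ne_top_of_le_ne_top ht (hτt i hi)
  have key : (S : ℝ≥0∞) + ((j : ℕ) + 1 : ℕ) ≤ (∑ i ∈ Finset.Iic j, (τ i)⁻¹) * (2 * t) := by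
    have h1 : (S : ℝ≥0∞) ≤ ∑ i ∈ Finset.Iic j, (τ i)⁻¹ * t := by
      calc (S : ℝ≥0∞) ≤ ((∑ i ∈ Finset.Iic j, d i : ℕ) : ℝ≥0∞) := by
            rw [Finset.sum_subset (Finset.subset_univ _) fun i _ hi => hIic i hi]
            exact_mod_cast hsum
        _ ≤ _ := by
            rw [Nat.cast_sum]
            refine Finset.sum_le_sum fun i hi => ?_
            rw [← ENNReal.mul_le_iff_le_inv (h0 i hi) (hfin i hi), mul_comm]
            exact hd i
    have h2 : (((j : ℕ) + 1 : ℕ) : ℝ≥0∞) ≤ ∑ i ∈ Finset.Iic j, (τ i)⁻¹ * t := by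
      rw [← sum_Iic_one j, Nat.cast_sum]
      refine Finset.sum_le_sum fun i hi => ?_
      rw [← ENNReal.mul_le_iff_le_inv (h0 i hi) (hfin i hi), Nat.cast_one, mul_one]
      exact hτt i hi
    rw [mul_left_comm, two_mul, Finset.sum_mul]
    exact add_le_add h1 h2
  rw [mul_comm, ← div_eq_mul_inv]
  exact ENNReal.div_le_of_le_mul' key

end Equilibrium

/-! ### Lower bounds for the times of the subroutines -/

section LowerBounds

variable {n m : ℕ}

theorem Workers.sum_count_assign (dur : Durations n m) (w : Workers n m) (i : Fin n) (k : Fin m) :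
    ∑ l, (w.assign dur i k).count l = ∑ l, w.count l + 1 := by
  rw [← Finset.sum_erase_add _ _ (Finset.mem_univ i), ← Finset.sum_erase_add _ w.count
    (Finset.mem_univ i)]
  have h : ∑ l ∈ Finset.univ.erase i, (w.assign dur i k).count l =
      ∑ l ∈ Finset.univ.erase i, w.count l :=
    Finset.sum_congr rfl fun l hl => by simp [Workers.assign, Finset.ne_of_mem_erase hl]
  rw [h]
  simp [Workers.assign, add_assoc]

/-- Every task of worker `i` takes time `τ i`, and no worker has started its present task after
the next finishing time. -/
def Workers.InStep (w : Workers n m) (τ : Fin n → ℝ≥0∞) : Prop :=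
  ∀ i, w.count i ≠ 0 ∧ w.finish i = w.count i * τ i ∧
    ∀ k, ((w.count i - 1 : ℕ) : ℝ≥0∞) * τ i ≤ w.finish k

theorem Workers.inStep_start {dur : Durations n m} {τ : Fin n → ℝ≥0∞}
    (hdur : ∀ i r j, dur i r j = τ i) (task : Fin n → Fin m) :
    (Workers.start dur task).InStep τ := fun i => by
  simp [Workers.start, hdur]

variable [NeZero n]

theorem Workers.InStep.count_assign_sub_one_mul_le {dur : Durations n m} {τ : Fin n → ℝ≥0∞}
    {w : Workers n m} (hw : w.InStep τ) (j : Fin m) (i : Fin n) :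
    (((w.assign dur w.next j).count i - 1 : ℕ) : ℝ≥0∞) * τ i ≤ w.finish w.next := by
  by_cases hi : i = w.next
  · subst hi
    simpa [Workers.assign] using (hw _).2.1.ge
  · simpa [Workers.assign, hi] using (hw i).2.2 w.next

theorem Workers.InStep.assign {dur : Durations n m} {τ : Fin n → ℝ≥0∞}
    (hdur : ∀ i r j, dur i r j = τ i) {w : Workers n m} (hw : w.InStep τ) (j : Fin m) :
    (w.assign dur w.next j).InStep τ := by
  intro i
  refine ⟨?_, ?_, fun k => (hw.count_assign_sub_one_mul_le j i).trans
    ((w.finish_next_le k).trans ?_)⟩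
  · by_cases hi : i = w.next
    · simp [Workers.assign, hi]
    · simpa [Workers.assign, hi] using (hw i).1
  · by_cases hi : i = w.next
    · subst hi
      simp [Workers.assign, hdur, add_mul, ← (hw _).2.1]
    · simpa [Workers.assign, hi] using (hw i).2.1
  · by_cases hk : k = w.next
    · subst hk
      simp [Workers.assign]
    · simp [Workers.assign, hk]

theorem Workers.InStep.le_finish_next [NeZero m] {τ : Fin n → ℝ≥0∞} (hτ : Monotone τ)
    {w : Workers n m} (hw : w.InStep τ) {N : ℕ} (hN : 0 < N) (hcount : n + N ≤ ∑ i, w.count i + 1) :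
    2⁻¹ * equilibriumTime N τ ≤ w.finish w.next := by
  rw [mul_comm, ← div_eq_mul_inv]
  refine ENNReal.div_le_of_le_mul' ?_
  -- A fictitious reassignment (index 0 is arbitrary) turns the delivery now due into a completed
  -- task. Worker i has then completed `w'.count i - 1` tasks, at least N in total.
  let dur : Durations n m := fun i _ _ => τ i
  let w' := w.assign dur w.next 0
  have hw' : w'.InStep τ := hw.assign (dur := dur) (fun _ _ _ => rfl) 0
  refine equilibriumTime_le_two_mul hτ hN (d := fun i => w'.count i - 1)
    (hw.count_assign_sub_one_mul_le 0) ?_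
  have h1 : ∑ i, (w'.count i - 1) + ∑ _i : Fin n, 1 = ∑ i, w'.count i := by
    rw [← Finset.sum_add_distrib]
    exact Finset.sum_congr rfl fun i _ => Nat.sub_add_cancel (Nat.pos_of_ne_zero (hw' i).1)
  have h2 : ∑ i, w'.count i = ∑ i, w.count i + 1 := w.sum_count_assign dur w.next 0
  rw [Finset.sum_const, Finset.card_univ, Fintype.card_fin, smul_eq_mul, mul_one] at h1
  omega

variable {E : Type*} [NormedAddCommGroup E] [InnerProductSpace ℝ E] [CompleteSpace E]
variable (f : Fin m → E → ℝ)

/-- A delivery adds at most one index to M, so there have been at least |M| deliveries, and m by the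
end. The bound holds for every sampling outcome. -/
theorem le_expect_gradientLoop_time [NeZero m] (x : E) {dur : Durations n m} {τ : Fin n → ℝ≥0∞}
    (hτ : Monotone τ) (hdur : ∀ i r j, dur i r j = τ i) (M : Finset (Fin m)) (g : E)
    (w : Workers n m) (hw : w.InStep τ) (hcount : n + M.card ≤ ∑ i, w.count i) :
    2⁻¹ * equilibriumTime m τ ≤ expect (gradientLoop f x dur M g w) (fun r => r.2) := by
  induction M, w using gradientLoop_induction dur generalizing g with | h M w ih =>
  have hins := Finset.card_insert_le (w.task w.next) M
  by_cases h : insert (w.task w.next) M = Finset.univ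
  · rw [expect_gradientLoop_of_eq_univ f x dur g h]
    refine hw.le_finish_next hτ (NeZero.pos m) ?_
    rw [h, Finset.card_univ, Fintype.card_fin] at hins
    omega
  · rw [expect_gradientLoop_of_ne_univ f x dur g h]
    have hcard : (insert (w.task w.next) M)ᶜ.card ≠ 0 := by
      rw [Finset.card_ne_zero, Finset.nonempty_iff_ne_empty, Ne, Finset.compl_eq_empty_iff]
      exact h
    rw [mul_comm _ (∑ _ ∈ _, _), ← div_eq_mul_inv,
      ENNReal.le_div_iff_mul_le (Or.inl (Nat.cast_ne_zero.2 hcard))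
        (Or.inl (ENNReal.natCast_ne_top _)), mul_comm, ← nsmul_eq_mul, ← Finset.sum_const]
    refine Finset.sum_le_sum fun j hj => ih j hj _ (hw.assign hdur j) ?_
    rw [w.sum_count_assign]
    omega

theorem le_expect_computeGradient_time [NeZero m] (x : E) {dur : Durations n m}
    {τ : Fin n → ℝ≥0∞} (hτ : Monotone τ) (hdur : ∀ i r j, dur i r j = τ i) :
    2⁻¹ * equilibriumTime m τ ≤ expect (computeGradient f x dur) (fun r => r.2) := by
  rw [computeGradient, expect_bind]
  refine le_expect_of_le _ fun task => le_expect_gradientLoop_time f x hτ hdur ∅ 0 _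
    (Workers.inStep_start hdur task) ?_
  simp [Workers.start]

theorem le_expect_batchLoop_time [NeZero m] (S : ℕ) (x y : E) {dur : Durations n m}
    {τ : Fin n → ℝ≥0∞} (hτ : Monotone τ) (hdur : ∀ i r j, dur i r j = τ i) {N : ℕ} (hN : 0 < N)
    (rounds : ℕ) (g : E) (t : ℝ≥0∞) (w : Workers n m) (hw : w.InStep τ)
    (hcount : n + N ≤ ∑ i, w.count i + (rounds + 1)) :
    2⁻¹ * equilibriumTime N τ ≤
      expect (batchLoop f S x y dur (rounds + 1) g t w) (fun r => r.2) := by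
  induction rounds generalizing g t w with
  | zero =>
    rw [expect_batchLoop_succ]
    refine le_expect_of_le _ fun k => ?_
    rw [expect_batchLoop_zero]
    exact hw.le_finish_next hτ hN hcount
  | succ rounds ih =>
    rw [expect_batchLoop_succ]
    refine le_expect_of_le _ fun k => ih _ _ _ (hw.assign hdur k) ?_
    rw [w.sum_count_assign]
    omega

theorem le_expect_computeBatchDifference_time [NeZero m] {S : ℕ} (hS : 0 < S) (x y : E)
    {dur : Durations n m} {τ : Fin n → ℝ≥0∞} (hτ : Monotone τ) (hdur : ∀ i r j, dur i r j = τ i) :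
    2⁻¹ * equilibriumTime S τ ≤
      expect (computeBatchDifference f S x y dur) (fun r => r.2) := by
  rw [computeBatchDifference, expect_bind]
  refine le_expect_of_le _ fun task => ?_
  obtain ⟨R, rfl⟩ := Nat.exists_eq_succ_of_ne_zero hS.ne'
  refine le_expect_batchLoop_time f _ x y hτ hdur hS R 0 0 _ (Workers.inStep_start hdur task) ?_
  simp [Workers.start]

end LowerBounds

/-! ### The total time -/

section TotalTime

variable {E : Type*} [NormedAddCommGroup E] [InnerProductSpace ℝ E] [CompleteSpace E]
variable {n m : ℕ} [NeZero n] [NeZero m] (f : Fin m → E → ℝ)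

theorem expect_step_time (T : ComputeTimes E n m) (γ : ℝ) (S : ℕ) (p : ℝ≥0) (hp : p ≤ 1)
    (s : State E) :
    expect (step f T γ S p hp s) State.time = s.time +
      (p * expect (computeGradient f (s.x s.k - γ • s.g) (T.grad s)) (fun r => r.2) +
      (1 - p) * expect (computeBatchDifference f S (s.x s.k - γ • s.g) (s.x s.k) (T.diff s))
        (fun r => r.2)) := by
  have h : (p : ℝ≥0∞) + (1 - p) = 1 := add_tsub_cancel_of_le (by exact_mod_cast hp)
  rw [step, expect_bind, expect_coin]
  simp only [if_true, Bool.false_eq_true, if_false, expect_map, Function.comp_def, expect_add,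
    expect_const]
  rw [mul_add, mul_add, add_add_add_comm, ← add_mul, h, one_mul]

theorem expect_step_time_le (hnm : (n : ℝ) * Real.log n ≤ m) {T : ComputeTimes E n m}
    {τ : Fin n → ℝ≥0∞} (hT : T.BoundedBy τ) (γ : ℝ) {S : ℕ} (hS : 0 < S) (hSm : S ≤ m) {p : ℝ≥0}
    (hp : p ≤ 1) (hpS : p = (S : ℝ≥0) / (m : ℝ≥0)) (s : State E) :
    expect (step f T γ S p hp s) State.time ≤ s.time + 20 * equilibriumTime S τ := by
  rw [expect_step_time]
  gcongr
  have h1 := expect_computeGradient_time_le f hnm (s.x s.k - γ • s.g) (hT.2.1 s)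
  have h2 := expect_computeBatchDifference_time_le f hS (s.x s.k - γ • s.g) (s.x s.k)
    (dur := T.diff s) (τ := fun i => 2 * τ i) fun i r j => by
      rw [two_mul]
      exact add_le_add (hT.2.2 _ _ _) (hT.2.2 _ _ _)
  rw [equilibriumTime_const_mul (by norm_num) (by norm_num)] at h2
  have h3 : (p : ℝ≥0∞) * equilibriumTime m τ ≤ equilibriumTime S τ := by
    have : (p : ℝ≥0∞) = (S : ℝ≥0∞) / m := by
      rw [hpS, ENNReal.coe_div (Nat.cast_ne_zero.2 (NeZero.ne m))]
      simp
    rw [this]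
    exact div_mul_equilibriumTime_le (NeZero.pos m) hSm τ
  calc _ ≤ (p : ℝ≥0∞) * (18 * equilibriumTime m τ) + 1 * (2 * equilibriumTime S τ) := by
        gcongr
        exact tsub_le_self
    _ ≤ 18 * equilibriumTime S τ + 2 * equilibriumTime S τ := by
        rw [mul_left_comm, one_mul]
        gcongr
    _ = _ := by
        rw [← add_mul]
        norm_num

/-- Both outcomes of the coin cost at least t*(S)/2: a full gradient because t*(m) ≥ t*(S), a batch
because its tasks last 2τ_i. -/
theorem le_expect_step_time {τ : Fin n → ℝ≥0∞} (hτ : Monotone τ) (γ : ℝ) {S : ℕ} (hS : 0 < S)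
    (hSm : S ≤ m) {p : ℝ≥0} (hp : p ≤ 1) (s : State E) :
    s.time + 2⁻¹ * equilibriumTime S τ ≤
      expect (step f (ComputeTimes.exact E m τ) γ S p hp s) State.time := by
  rw [expect_step_time]
  gcongr
  have h1 := le_expect_computeGradient_time f (s.x s.k - γ • s.g)
    (dur := (ComputeTimes.exact E m τ).grad s) hτ fun _ _ _ => rfl
  have h2 := le_expect_computeBatchDifference_time f hS (s.x s.k - γ • s.g) (s.x s.k)
    (dur := (ComputeTimes.exact E m τ).diff s) (τ := fun i => 2 * τ i)
    (fun i j hij => mul_le_mul_right (hτ hij) _) fun i r j => by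
      rw [two_mul]
      rfl
  rw [equilibriumTime_const_mul (by norm_num) (by norm_num)] at h2
  have h : (p : ℝ≥0∞) + (1 - p) = 1 := add_tsub_cancel_of_le (by exact_mod_cast hp)
  calc 2⁻¹ * equilibriumTime S τ
      = p * (2⁻¹ * equilibriumTime S τ) + (1 - p) * (2⁻¹ * equilibriumTime S τ) := by
        rw [← add_mul, h, one_mul]
    _ ≤ _ := by
        gcongr
        · exact (mul_le_mul_right (equilibriumTime_mono hSm τ) _).trans h1
        · refine le_trans ?_ h2
          gcongr
          exact le_mul_of_one_le_left zero_le (by norm_num)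

theorem expect_run_time_le (hnm : (n : ℝ) * Real.log n ≤ m) {T : ComputeTimes E n m}
    {τ : Fin n → ℝ≥0∞} (hT : T.BoundedBy τ) (γ : ℝ) {S : ℕ} (hS : 0 < S) (hSm : S ≤ m) {p : ℝ≥0}
    (hp : p ≤ 1) (hpS : p = (S : ℝ≥0) / (m : ℝ≥0)) (x0 : E) (K : ℕ) :
    expect (run f T γ S p hp x0 K) State.time ≤
      18 * equilibriumTime m τ + K * (20 * equilibriumTime S τ) := by
  induction K with
  | zero =>
    rw [run, expect_map]
    simpa [Function.comp_def] using expect_computeGradient_time_le f hnm x0 hT.1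
  | succ K ih =>
    rw [run, expect_bind]
    refine (expect_mono _ fun s => expect_step_time_le f hnm hT γ hS hSm hp hpS s).trans ?_
    rw [expect_add, expect_const, Nat.cast_add, Nat.cast_one, add_mul, one_mul, ← add_assoc]
    gcongr

theorem le_expect_run_time {τ : Fin n → ℝ≥0∞} (hτ : Monotone τ) (γ : ℝ) {S : ℕ} (hS : 0 < S)
    (hSm : S ≤ m) {p : ℝ≥0} (hp : p ≤ 1) (x0 : E) (K : ℕ) :
    2⁻¹ * equilibriumTime m τ + K * (2⁻¹ * equilibriumTime S τ) ≤
      expect (run f (ComputeTimes.exact E m τ) γ S p hp x0 K) State.time := by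
  induction K with
  | zero =>
    rw [run, expect_map]
    simpa [Function.comp_def] using le_expect_computeGradient_time f x0
      (dur := (ComputeTimes.exact E m τ).preproc) hτ fun _ _ _ => rfl
  | succ K ih =>
    rw [run, expect_bind]
    refine le_trans ?_ (expect_mono _ fun s => le_expect_step_time f hτ γ hS hSm hp s)
    rw [expect_add, expect_const, Nat.cast_add, Nat.cast_one, add_mul, one_mul, ← add_assoc]
    gcongr

theorem expect_freyaPAGE_time (T : ComputeTimes E n m) (γ : ℝ) (S : ℕ) (p : ℝ≥0) (hp : p ≤ 1)
    (x0 : E) (K : ℕ) (hK : 0 < K) :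
    expect (freyaPAGE f T γ S p hp x0 K hK) (fun r => r.2) =
      expect (run f T γ S p hp x0 K) State.time := by
  rw [freyaPAGE, expect_bind]
  simp only [expect_map, Function.comp_def, expect_const]

end TotalTime

/-! ### The vectors computed by the subroutines -/

section Vectors

variable {E : Type*} [NormedAddCommGroup E] [InnerProductSpace ℝ E] [CompleteSpace E] {n m : ℕ}

theorem hasGradientAt_objective {f : Fin m → E → ℝ} (hf : ∀ i, Differentiable ℝ (f i)) (x : E) :
    HasGradientAt (objective f) (∑ i, (1 / (m : ℝ)) • gradient (f i) x) x := by
  rw [hasGradientAt_iff_hasFDerivAt, map_sum]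
  have h : HasFDerivAt (fun y => ∑ i, (1 / (m : ℝ)) * f i y)
      (∑ i, (InnerProductSpace.toDual ℝ E) ((1 / (m : ℝ)) • gradient (f i) x)) x := by
    refine HasFDerivAt.fun_sum fun i _ => ?_
    rw [map_smul]
    exact ((hf i x).hasGradientAt.hasFDerivAt).const_mul _
  refine h.congr_of_eventuallyEq (Filter.Eventually.of_forall fun y => ?_)
  rw [objective, Finset.mul_sum]

theorem gradient_objective {f : Fin m → E → ℝ} (hf : ∀ i, Differentiable ℝ (f i)) (x : E) :
    gradient (objective f) x = ∑ i, (1 / (m : ℝ)) • gradient (f i) x :=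
  (hasGradientAt_objective hf x).gradient

/-- The partial sum plus the terms still missing is invariant, so the output is deterministic; an
arbitrary test function φ expresses this. -/
theorem expect_gradientLoop_vector [NeZero n] (f : Fin m → E → ℝ) (x : E) (dur : Durations n m)
    (φ : E → ℝ≥0∞) (M : Finset (Fin m)) (g : E) (w : Workers n m) :
    expect (gradientLoop f x dur M g w) (fun r => φ r.1) =
      φ (g + ∑ q ∈ Mᶜ, (1 / (m : ℝ)) • gradient (f q) x) := by
  induction M, w using gradientLoop_induction dur generalizing g with | h M w ih =>
  have hsum : (if w.task w.next ∈ M then g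
      else g + (1 / (m : ℝ)) • gradient (f (w.task w.next)) x) +
      ∑ q ∈ (insert (w.task w.next) M)ᶜ, (1 / (m : ℝ)) • gradient (f q) x =
      g + ∑ q ∈ Mᶜ, (1 / (m : ℝ)) • gradient (f q) x := by
    split_ifs with hq
    · rw [Finset.insert_eq_of_mem hq]
    · rw [Finset.compl_insert, add_assoc, Finset.add_sum_erase Mᶜ
        (fun q => (1 / (m : ℝ)) • gradient (f q) x) (Finset.mem_compl.2 hq)]
  by_cases h : insert (w.task w.next) M = Finset.univ
  · rw [expect_gradientLoop_of_eq_univ f x dur g h, ← hsum, h]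
    simp
  · have hcard : (insert (w.task w.next) M)ᶜ.card ≠ 0 := by
      rw [Finset.card_ne_zero, Finset.nonempty_iff_ne_empty, Ne, Finset.compl_eq_empty_iff]
      exact h
    rw [expect_gradientLoop_of_ne_univ f x dur g h, Finset.sum_congr rfl fun j hj => ih j hj _,
      hsum, Finset.sum_const, nsmul_eq_mul, ← mul_assoc, ENNReal.inv_mul_cancel
        (Nat.cast_ne_zero.2 hcard) (ENNReal.natCast_ne_top _), one_mul]

theorem expect_computeGradient_vector [NeZero n] [NeZero m] {f : Fin m → E → ℝ}
    (hf : ∀ i, Differentiable ℝ (f i)) (x : E) (dur : Durations n m) (φ : E → ℝ≥0∞) :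
    expect (computeGradient f x dur) (fun r => φ r.1) = φ (gradient (objective f) x) := by
  rw [computeGradient, expect_bind]
  simp only [expect_gradientLoop_vector, expect_const, gradient_objective hf, Finset.compl_empty,
    zero_add]

/-- A uniformly random family of indices stays so, and independent of its former value at `i`, if
its value at `i` is replaced by a new uniformly random index. -/
theorem expect_uniform_update [NeZero m] (i : Fin n) (F : Fin m → (Fin n → Fin m) → ℝ≥0∞) :
    (expect (PMF.uniformOfFintype (Fin n → Fin m)) fun task =>
      expect (PMF.uniformOfFintype (Fin m)) fun j => F (task i) (Function.update task i j)) =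
    expect (PMF.uniformOfFintype (Fin m)) fun q =>
      expect (PMF.uniformOfFintype (Fin n → Fin m)) (F q) := by
  simp only [expect_uniformOfFintype, ← Finset.mul_sum]
  rw [mul_left_comm]
  congr 2
  -- Exchanging the value at i with the fresh index is an involution of the pairs, hence preserves
  -- the uniform distribution.
  let e : (Fin n → Fin m) × Fin m → (Fin n → Fin m) × Fin m := fun a =>
    (Function.update a.1 i a.2, a.1 i)
  have he : Function.Involutive e := fun a => by simp [e]
  rw [Finset.sum_comm, ← Fintype.sum_prod_type_right', ← Fintype.sum_prod_type_right']
  exact Fintype.sum_equiv he.toPerm _ _ fun a => rfl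

theorem expect_uniform_ofReal [NeZero m] {h : Fin m → ℝ} (hh : ∀ q, 0 ≤ h q) :
    expect (PMF.uniformOfFintype (Fin m)) (fun q => ENNReal.ofReal (h q)) =
      ENNReal.ofReal ((1 / (m : ℝ)) * ∑ q, h q) := by
  have hm : (0 : ℝ) < m := Nat.cast_pos.2 (NeZero.pos m)
  rw [expect_uniformOfFintype, ENNReal.ofReal_mul (by positivity),
    ENNReal.ofReal_sum_of_nonneg fun q _ => hh q, one_div, ENNReal.ofReal_inv_of_pos hm,
    ENNReal.ofReal_natCast, Fintype.card_fin]

/-- Bias-variance decomposition: the cross term vanishes because the deviations from the mean D sum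
to zero. -/
theorem average_norm_add_sq {E : Type*} [NormedAddCommGroup E] [InnerProductSpace ℝ E] {m : ℕ}
    [NeZero m] {d : Fin m → E} {D : E}
    (hD : D = ∑ q, (1 / (m : ℝ)) • d q) (a : E) (s : ℝ) :
    (1 / (m : ℝ)) * ∑ q, ‖a + s • d q‖ ^ 2 =
      ‖a + s • D‖ ^ 2 + s ^ 2 * ((1 / (m : ℝ)) * ∑ q, ‖d q - D‖ ^ 2) := by
  have hm : (m : ℝ) ≠ 0 := Nat.cast_ne_zero.2 (NeZero.ne m)
  have hsum : ∑ q, (d q - D) = 0 := by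
    rw [Finset.sum_sub_distrib, Finset.sum_const, Finset.card_univ, Fintype.card_fin, hD,
      ← Finset.smul_sum, ← Nat.cast_smul_eq_nsmul ℝ, smul_smul, mul_one_div_cancel hm, one_smul,
      sub_self]
  have hq : ∀ q, ‖a + s • d q‖ ^ 2 = ‖a + s • D‖ ^ 2 +
      2 * inner ℝ (a + s • D) (s • (d q - D)) + s ^ 2 * ‖d q - D‖ ^ 2 := fun q => by
    have : a + s • d q = (a + s • D) + s • (d q - D) := by
      rw [smul_sub]
      abel
    rw [this, norm_add_sq_real, norm_smul, mul_pow, Real.norm_eq_abs, sq_abs]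
  simp only [hq]
  rw [Finset.sum_add_distrib, Finset.sum_add_distrib, ← Finset.mul_sum, ← Finset.mul_sum,
    ← inner_sum, ← Finset.smul_sum, hsum]
  simp only [smul_zero, inner_zero_right, mul_zero, add_zero, Finset.sum_const, Finset.card_univ,
    Fintype.card_fin, nsmul_eq_mul]
  field_simp

/-- Averaging over the tasks in progress is what lets the induction close: after a delivery they are
again uniform and independent of the delivered index. Each round then contributes one mean and one
variance term. -/
theorem expect_batchLoop_norm_sub_sq [NeZero n] [NeZero m] (f : Fin m → E → ℝ) (S : ℕ) (x y : E)
    {dur : Durations n m} (hdur : ∀ i r j j', dur i r j = dur i r j') {D : E}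
    (hD : D = ∑ q, (1 / (m : ℝ)) • (gradient (f q) x - gradient (f q) y)) (c : E) (rounds : ℕ)
    (g : E) (t : ℝ≥0∞) (finish : Fin n → ℝ≥0∞) (count : Fin n → ℕ) :
    (expect (PMF.uniformOfFintype (Fin n → Fin m)) fun task =>
      expect (batchLoop f S x y dur rounds g t ⟨task, finish, count⟩) fun r =>
        ENNReal.ofReal (‖r.1 - c‖ ^ 2)) =
    ENNReal.ofReal (‖g - c + (rounds * (1 / (S : ℝ))) • D‖ ^ 2 + rounds * ((1 / (S : ℝ)) ^ 2 *
      ((1 / (m : ℝ)) * ∑ q, ‖gradient (f q) x - gradient (f q) y - D‖ ^ 2))) := by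
  induction rounds generalizing g t finish count with
  | zero => simp [expect_batchLoop_zero, expect_const]
  | succ rounds ih =>
    -- `Workers.next` looks only at the finishing times, so dummy tasks determine the same worker i
    -- for every `task`.
    let w₀ : Workers n m := ⟨fun _ => 0, finish, count⟩
    let i := w₀.next
    set d : Fin m → E := fun q => gradient (f q) x - gradient (f q) y
    have hassign : ∀ (task : Fin n → Fin m) (j : Fin m),
        Workers.assign dur (⟨task, finish, count⟩ : Workers n m) i j =
          ⟨Function.update task i j, Function.update finish i (finish i + dur i (count i) 0),
            Function.update count i (count i + 1)⟩ := fun task j => by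
      rw [Workers.assign, hdur _ _ j 0]
    have hstep : ∀ task : Fin n → Fin m,
        expect (batchLoop f S x y dur (rounds + 1) g t ⟨task, finish, count⟩)
          (fun r => ENNReal.ofReal (‖r.1 - c‖ ^ 2)) =
        expect (PMF.uniformOfFintype (Fin m)) fun j =>
          expect (batchLoop f S x y dur rounds (g + (1 / (S : ℝ)) • d (task i)) (finish i)
            ⟨Function.update task i j, Function.update finish i (finish i + dur i (count i) 0),
              Function.update count i (count i + 1)⟩)
            (fun r => ENNReal.ofReal (‖r.1 - c‖ ^ 2)) := fun task => by
      rw [expect_batchLoop_succ]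
      simp only [← hassign]
      rfl
    simp only [hstep]
    rw [expect_uniform_update i fun q task =>
      expect (batchLoop f S x y dur rounds (g + (1 / (S : ℝ)) • d q) (finish i)
        ⟨task, Function.update finish i (finish i + dur i (count i) 0),
          Function.update count i (count i + 1)⟩) (fun r => ENNReal.ofReal (‖r.1 - c‖ ^ 2))]
    simp only [ih]
    set V := (1 / (m : ℝ)) * ∑ q, ‖gradient (f q) x - gradient (f q) y - D‖ ^ 2 with hV
    have hV0 : 0 ≤ V := by positivity
    rw [expect_uniform_ofReal fun q => by positivity, Finset.sum_add_distrib, mul_add]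
    have h1 : ∀ q, g + (1 / (S : ℝ)) • d q - c + (rounds * (1 / (S : ℝ))) • D =
        (g - c + (rounds * (1 / (S : ℝ))) • D) + (1 / (S : ℝ)) • d q := fun q => by abel
    simp only [h1]
    have hm : (m : ℝ) ≠ 0 := Nat.cast_ne_zero.2 (NeZero.ne m)
    rw [average_norm_add_sq hD, add_assoc (g - c), ← add_smul, ← hV, Finset.sum_const,
      Finset.card_univ, Fintype.card_fin, nsmul_eq_mul, ← mul_assoc (1 / (m : ℝ)),
      one_div_mul_cancel hm, Nat.cast_add, Nat.cast_one, add_mul _ _ (1 / (S : ℝ)), one_mul,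
      one_mul]
    congr 1
    ring

theorem expect_computeBatchDifference_norm_sq_le [NeZero n] [NeZero m] {f : Fin m → E → ℝ}
    (hf : ∀ i, Differentiable ℝ (f i)) {L : ℝ} (hL : HessianVariance L f) {S : ℕ} (hS : 0 < S)
    (x y : E) {dur : Durations n m} (hdur : ∀ i r j j', dur i r j = dur i r j') (g : E) :
    expect (computeBatchDifference f S x y dur)
      (fun r => ENNReal.ofReal (‖g + r.1 - gradient (objective f) x‖ ^ 2)) ≤
    ENNReal.ofReal (‖g - gradient (objective f) y‖ ^ 2 + L ^ 2 / S * ‖x - y‖ ^ 2) := by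
  have hS0 : (0 : ℝ) < S := Nat.cast_pos.2 hS
  set D := gradient (objective f) x - gradient (objective f) y with hDdef
  have hD : D = ∑ q, (1 / (m : ℝ)) • (gradient (f q) x - gradient (f q) y) := by
    simp only [hDdef, gradient_objective hf, smul_sub, Finset.sum_sub_distrib]
  have h0 : ∀ v : E, g + v - gradient (objective f) x = v - (gradient (objective f) x - g) :=
    fun v => by abel
  have hrw := expect_batchLoop_norm_sub_sq f S x y hdur hD (gradient (objective f) x - g) S 0 0
  have hfinish : ∀ task : Fin n → Fin m, Workers.start dur task =
      ⟨task, fun i => dur i 0 0, fun _ => 1⟩ := fun task => by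
    rw [Workers.start]
    congr 1
    funext i
    exact hdur _ _ _ _
  rw [computeBatchDifference, expect_bind]
  simp only [h0, hfinish]
  rw [hrw]
  refine ENNReal.ofReal_le_ofReal (add_le_add (le_of_eq ?_) ?_)
  · rw [mul_one_div_cancel hS0.ne', one_smul]
    congr 2
    rw [hDdef]
    abel
  · have h1 := hL x y
    calc (S : ℝ) * ((1 / (S : ℝ)) ^ 2 *
          ((1 / (m : ℝ)) * ∑ q, ‖gradient (f q) x - gradient (f q) y - D‖ ^ 2))
        ≤ (S : ℝ) * ((1 / (S : ℝ)) ^ 2 * (L ^ 2 * ‖x - y‖ ^ 2)) := by gcongr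
      _ = _ := by field_simp

end Vectors

/-! ### Convergence of the PAGE iteration -/

section Convergence

variable {E : Type*} [NormedAddCommGroup E] [InnerProductSpace ℝ E] [CompleteSpace E]

/-- The descent lemma for smooth functions. -/
theorem IsSmoothWith.le_add_inner_add {L : ℝ} {h : E → ℝ} (hh : IsSmoothWith L h) (x v : E) :
    h (x + v) ≤ h x + inner ℝ (gradient h x) v + L / 2 * ‖v‖ ^ 2 := by
  -- The function h along the segment minus the nonconstant part of its quadratic model. The
  -- Lipschitz bound makes the derivative nonpositive; compare t = 0 and t = 1.
  let φ : ℝ → ℝ := fun t => h (x + t • v) - t * inner ℝ (gradient h x) v - L / 2 * t ^ 2 * ‖v‖ ^ 2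
  have hφ : ∀ t, HasDerivAt φ (inner ℝ (gradient h (x + t • v)) v - inner ℝ (gradient h x) v
      - L * t * ‖v‖ ^ 2) t := by
    intro t
    have h1 : HasDerivAt (fun t : ℝ => x + t • v) v t := by
      simpa using ((hasDerivAt_id t).smul_const v).const_add x
    have h2 := (hh.1 (x + t • v)).hasGradientAt.hasFDerivAt.comp_hasDerivAt t h1
    have h3 : HasDerivAt (fun t : ℝ => t * inner ℝ (gradient h x) v)
        (inner ℝ (gradient h x) v) t := by
      simpa using (hasDerivAt_id t).mul_const (inner ℝ (gradient h x) v)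
    have h4 : HasDerivAt (fun t : ℝ => L / 2 * t ^ 2 * ‖v‖ ^ 2) (L * t * ‖v‖ ^ 2) t := by
      refine (((hasDerivAt_pow 2 t).const_mul (L / 2)).mul_const (‖v‖ ^ 2)).congr_deriv ?_
      rw [Nat.cast_ofNat, pow_one]
      ring
    exact (h2.sub h3).sub h4
  have hanti : AntitoneOn φ (Set.Icc 0 1) := by
    refine antitoneOn_of_deriv_nonpos (convex_Icc 0 1)
      (fun t _ => (hφ t).continuousAt.continuousWithinAt)
      (fun t _ => (hφ t).differentiableAt.differentiableWithinAt) fun t ht => ?_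
    rw [interior_Icc] at ht
    rw [(hφ t).deriv, ← inner_sub_left, sub_nonpos]
    calc inner ℝ (gradient h (x + t • v) - gradient h x) v
        ≤ ‖gradient h (x + t • v) - gradient h x‖ * ‖v‖ := real_inner_le_norm _ _
      _ ≤ (L * ‖x + t • v - x‖) * ‖v‖ := by
          gcongr
          exact hh.2 _ _
      _ = _ := by
          rw [add_sub_cancel_left, norm_smul, Real.norm_of_nonneg ht.1.le]
          ring
  have := hanti (Set.left_mem_Icc.2 zero_le_one) (Set.right_mem_Icc.2 zero_le_one) zero_le_one
  simp only [φ, one_smul, zero_smul, add_zero] at this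
  linarith

/-- One step `x ↦ x - γ g` with an inexact gradient `g`. -/
theorem IsSmoothWith.sub_smul_le {L : ℝ} {h : E → ℝ} (hh : IsSmoothWith L h) {γ B : ℝ}
    (hγ : 0 < γ) (hB : γ * L + γ ^ 2 * B ≤ 1) (x g : E) :
    h (x - γ • g) + γ / 2 * ‖gradient h x‖ ^ 2 + γ / 2 * B * ‖x - γ • g - x‖ ^ 2 ≤
      h x + γ / 2 * ‖g - gradient h x‖ ^ 2 := by
  have h1 := hh.le_add_inner_add x (-(γ • g))
  rw [← sub_eq_add_neg, inner_neg_right, inner_smul_right, norm_neg, norm_smul, mul_pow,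
    Real.norm_eq_abs, sq_abs] at h1
  have h2 := norm_sub_sq_real g (gradient h x)
  rw [real_inner_comm] at h2
  have h3 : ‖x - γ • g - x‖ ^ 2 = γ ^ 2 * ‖g‖ ^ 2 := by
    rw [sub_sub_cancel_left, norm_neg, norm_smul, mul_pow, Real.norm_eq_abs, sq_abs]
  rw [h3]
  nlinarith [mul_le_mul_of_nonneg_left hB (by positivity : 0 ≤ γ / 2 * ‖g‖ ^ 2)]

variable {n m : ℕ} [NeZero n] [NeZero m]

/-- The Lyapunov function: the PAGE potential plus the accumulated squared gradients. -/
noncomputable def lyapunov (h : E → ℝ) (hmin γ p : ℝ) (s : State E) : ℝ≥0∞ :=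
  ENNReal.ofReal (h (s.x s.k) - hmin + γ / (2 * p) * ‖s.g - gradient h (s.x s.k)‖ ^ 2) +
    ∑ k ∈ Finset.range s.k, ENNReal.ofReal (γ / 2 * ‖gradient h (s.x k)‖ ^ 2)

/-- The coin leaves a fraction 1 - p of the error e = ‖g - ∇f(x)‖². With weight γ/(2p) this frees
γe/2, the error term of the descent step. The new variance is absorbed by the ‖y - x‖² term in
`IsSmoothWith.sub_smul_le`, with B = ((1-p)/p)(L'²/S). -/
theorem expect_step_lyapunov_le {f : Fin m → E → ℝ} (hf : ∀ i, Differentiable ℝ (f i))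
    {L L' fmin : ℝ} (hL : IsSmoothWith L (objective f)) (hmin : ∀ x, fmin ≤ objective f x)
    (hL' : HessianVariance L' f) (T : ComputeTimes E n m) {γ : ℝ} (hγ : 0 < γ) {S : ℕ}
    (hS : 0 < S) {p : ℝ≥0} (hp : p ≤ 1) (hp0 : 0 < p)
    (hγL : γ * L + γ ^ 2 * ((1 - p) / p * (L' ^ 2 / S)) ≤ 1) (s : State E) :
    expect (step f T γ S p hp s) (lyapunov (objective f) fmin γ p) ≤
      lyapunov (objective f) fmin γ p s := by
  have hp0' : (0 : ℝ) < p := hp0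
  have hp' : (0 : ℝ) ≤ 1 - p := sub_nonneg.2 (by exact_mod_cast hp)
  set F := objective f
  set x := s.x s.k with hx
  set y := x - γ • s.g with hy
  set e := ‖s.g - gradient F x‖ ^ 2 with he
  set c := ∑ k ∈ Finset.range s.k, ENNReal.ofReal (γ / 2 * ‖gradient F (s.x k)‖ ^ 2) with hc
  set G := ENNReal.ofReal (γ / 2 * ‖gradient F x‖ ^ 2) with hG
  have hB : 0 ≤ γ / (2 * p) := by positivity
  have hA : 0 ≤ F y - fmin := sub_nonneg.2 (hmin y)
  have hlyap : ∀ v t, lyapunov F fmin γ p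
      { k := s.k + 1, x := Function.update s.x (s.k + 1) y, g := v, time := t } =
      ENNReal.ofReal (F y - fmin) +
        ENNReal.ofReal (γ / (2 * p)) * ENNReal.ofReal (‖v - gradient F y‖ ^ 2) + (c + G) := by
    intro v t
    rw [lyapunov]
    simp only [Function.update_self]
    rw [ENNReal.ofReal_add hA (by positivity), ENNReal.ofReal_mul hB, Finset.sum_range_succ]
    congr 2
    · refine Finset.sum_congr rfl fun k hk => ?_
      rw [Function.update_of_ne (by have := Finset.mem_range.1 hk; omega)]
    · rw [Function.update_of_ne (by omega)]
  have hbatch := expect_computeBatchDifference_norm_sq_le (n := n) hf hL' hS y x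
    (dur := T.diff s) (fun _ _ _ _ => rfl) s.g
  set Q := e + L' ^ 2 / S * ‖y - x‖ ^ 2 with hQ
  have hQ0 : 0 ≤ Q := by positivity
  have hBQ : 0 ≤ (1 - (p : ℝ)) * (γ / (2 * p) * Q) := mul_nonneg hp' (mul_nonneg hB hQ0)
  have hgrad := expect_computeGradient_vector hf y (T.grad s)
    (fun v => ENNReal.ofReal (F y - fmin) +
        ENNReal.ofReal (γ / (2 * p)) * ENNReal.ofReal (‖v - gradient F y‖ ^ 2) + (c + G))
  have hcoin : (p : ℝ≥0∞) + (1 - p) = 1 := add_tsub_cancel_of_le (by exact_mod_cast hp)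
  have hcoin' : (1 : ℝ≥0∞) - p = ENNReal.ofReal (1 - p) := by
    rw [ENNReal.ofReal_sub _ p.coe_nonneg, ENNReal.ofReal_one, ENNReal.ofReal_coe_nnreal]
  rw [step, expect_bind, expect_coin]
  simp only [if_true, Bool.false_eq_true, if_false, expect_map, Function.comp_def]
  simp only [← hx, ← hy, hlyap]
  rw [hgrad]
  simp only [expect_add, expect_const, expect_const_mul]
  calc _ ≤ (p : ℝ≥0∞) * (ENNReal.ofReal (F y - fmin) + ENNReal.ofReal (γ / (2 * p)) *
          ENNReal.ofReal (‖gradient F y - gradient F y‖ ^ 2) + (c + G)) +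
        (1 - p) * (ENNReal.ofReal (F y - fmin) +
          ENNReal.ofReal (γ / (2 * p)) * ENNReal.ofReal Q + (c + G)) := by
        gcongr
    _ = ((p : ℝ≥0∞) + (1 - p)) * (ENNReal.ofReal (F y - fmin)) +
        (1 - p) * (ENNReal.ofReal (γ / (2 * p)) * ENNReal.ofReal Q) +
        ((p : ℝ≥0∞) + (1 - p)) * (c + G) := by
        rw [sub_self, norm_zero]
        simp only [ne_eq, OfNat.ofNat_ne_zero, not_false_eq_true, zero_pow, ENNReal.ofReal_zero,
          mul_zero, add_zero]
        ring
    _ = ENNReal.ofReal (F y - fmin + (1 - p) * (γ / (2 * p) * Q) +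
          γ / 2 * ‖gradient F x‖ ^ 2) + c := by
        rw [hcoin, one_mul, one_mul, hcoin', ← ENNReal.ofReal_mul hB, ← ENNReal.ofReal_mul hp',
          ENNReal.ofReal_add (add_nonneg hA hBQ) (by positivity), ENNReal.ofReal_add hA hBQ, ← hG]
        ring
    _ ≤ _ := by
        rw [lyapunov]
        refine add_le_add_left (ENNReal.ofReal_le_ofReal ?_) _
        have h1 := hL.sub_smul_le hγ hγL x s.g
        rw [← hy, ← he] at h1
        have h2 : (1 - (p : ℝ)) * (γ / (2 * p) * Q) =
            γ / 2 * ((1 - p) / p * (L' ^ 2 / S)) * ‖y - x‖ ^ 2 + γ / (2 * p) * e - γ / 2 * e := by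
          rw [hQ]
          field_simp
          ring
        rw [h2]
        linarith

theorem expect_run_lyapunov_le {f : Fin m → E → ℝ} (hf : ∀ i, Differentiable ℝ (f i))
    {L L' fmin : ℝ} (hL : IsSmoothWith L (objective f)) (hmin : ∀ x, fmin ≤ objective f x)
    (hL' : HessianVariance L' f) (T : ComputeTimes E n m) {γ : ℝ} (hγ : 0 < γ) {S : ℕ}
    (hS : 0 < S) {p : ℝ≥0} (hp : p ≤ 1) (hp0 : 0 < p)
    (hγL : γ * L + γ ^ 2 * ((1 - p) / p * (L' ^ 2 / S)) ≤ 1) (x0 : E) (K : ℕ) :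
    expect (run f T γ S p hp x0 K) (lyapunov (objective f) fmin γ p) ≤
      ENNReal.ofReal (objective f x0 - fmin) := by
  induction K with
  | zero =>
    rw [run, expect_map]
    have := expect_computeGradient_vector hf x0 T.preproc fun v => ENNReal.ofReal
      (objective f x0 - fmin + γ / (2 * p) * ‖v - gradient (objective f) x0‖ ^ 2)
    simp only [sub_self, norm_zero, ne_eq, OfNat.ofNat_ne_zero, not_false_eq_true, zero_pow,
      mul_zero, add_zero] at this
    rw [← this]
    simp [lyapunov, Function.comp_def]
  | succ K ih =>
    rw [run, expect_bind]
    exact (expect_mono _ fun s =>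
      expect_step_lyapunov_le hf hL hmin hL' T hγ hS hp hp0 hγL s).trans ih

/-- Needed to identify the sum up to `s.k` in `lyapunov` with the sum over the K candidates for the
output. -/
theorem k_of_mem_support_run {f : Fin m → E → ℝ} {T : ComputeTimes E n m} {γ : ℝ} {S : ℕ}
    {p : ℝ≥0} {hp : p ≤ 1} {x0 : E} {K : ℕ} {s : State E}
    (hs : s ∈ (run f T γ S p hp x0 K).support) : s.k = K := by
  induction K generalizing s with
  | zero =>
    rw [run, PMF.mem_support_map_iff] at hs
    obtain ⟨r, -, rfl⟩ := hs
    rfl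
  | succ K ih =>
    rw [run, PMF.mem_support_bind_iff] at hs
    obtain ⟨s', hs', hs⟩ := hs
    rw [step, PMF.mem_support_bind_iff] at hs
    obtain ⟨c, -, hs⟩ := hs
    rw [← ih hs']
    cases c
    · simp only [Bool.false_eq_true, if_false, PMF.mem_support_map_iff] at hs
      obtain ⟨r, -, rfl⟩ := hs
      rfl
    · simp only [if_true, PMF.mem_support_map_iff] at hs
      obtain ⟨r, -, rfl⟩ := hs
      rfl

theorem expect_freyaPAGE_norm_gradient_sq_le {f : Fin m → E → ℝ}
    (hf : ∀ i, Differentiable ℝ (f i)) {L L' fmin : ℝ} (hL : IsSmoothWith L (objective f))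
    (hmin : ∀ x, fmin ≤ objective f x) (hL' : HessianVariance L' f) (T : ComputeTimes E n m)
    {γ : ℝ} (hγ : 0 < γ) {S : ℕ} (hS : 0 < S) {p : ℝ≥0} (hp : p ≤ 1) (hp0 : 0 < p)
    (hγL : γ * L + γ ^ 2 * ((1 - p) / p * (L' ^ 2 / S)) ≤ 1) (x0 : E) (K : ℕ) (hK : 0 < K) :
    expect (freyaPAGE f T γ S p hp x0 K hK)
        (fun r => ENNReal.ofReal (‖gradient (objective f) r.1‖ ^ 2)) ≤
      ENNReal.ofReal (2 / (γ * K) * (objective f x0 - fmin)) := by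
  have hK0 : (0 : ℝ) < K := Nat.cast_pos.2 hK
  rw [freyaPAGE, expect_bind]
  simp only [expect_map, Function.comp_def, expect_uniformOfFinset, Finset.card_range]
  calc _ = expect (run f T γ S p hp x0 K) fun s => ENNReal.ofReal (2 / (γ * K)) *
          ∑ k ∈ Finset.range s.k,
            ENNReal.ofReal (γ / 2 * ‖gradient (objective f) (s.x k)‖ ^ 2) := by
        refine expect_congr_support _ fun s hs => ?_
        rw [k_of_mem_support_run hs, Finset.mul_sum, Finset.mul_sum]
        refine Finset.sum_congr rfl fun k _ => ?_
        rw [← ENNReal.ofReal_natCast, ← ENNReal.ofReal_inv_of_pos hK0,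
          ← ENNReal.ofReal_mul (by positivity), ← ENNReal.ofReal_mul (by positivity)]
        congr 1
        field_simp
    _ ≤ expect (run f T γ S p hp x0 K) fun s => ENNReal.ofReal (2 / (γ * K)) *
          lyapunov (objective f) fmin γ p s := by
        refine expect_mono _ fun s => ?_
        gcongr
        exact le_add_self
    _ ≤ _ := by
        rw [expect_const_mul, ENNReal.ofReal_mul (by positivity)]
        gcongr
        exact expect_run_lyapunov_le hf hL hmin hL' T hγ hS hp hp0 hγL x0 K

end Convergence

/-! ### The parameters of the method -/

section Parameters

variable {m S : ℕ} {Lm Lpm : ℝ}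

/-- For S < m the root is at most √m / S, and S ≥ L±√m / L₋ by the ceiling. For S = m the
probability is 1 and the root vanishes. -/
theorem mul_sqrt_le (hm : 0 < m) (hLm : 0 < Lm) (hLpm : 0 ≤ Lpm)
    (hS : S = min (max ⌈Lpm * √(m : ℝ) / Lm⌉₊ 1) m) :
    Lpm * √((1 - (S : ℝ) / m) / ((S : ℝ) / m * S)) ≤ Lm := by
  have hm0 : (0 : ℝ) < m := Nat.cast_pos.2 hm
  have hS1 : 0 < S := by omega
  have hS0 : (0 : ℝ) < S := Nat.cast_pos.2 hS1
  rcases Nat.lt_or_ge S m with hlt | hge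
  · have hceil : Lpm * √(m : ℝ) / Lm ≤ S := by
      refine (Nat.le_ceil _).trans (Nat.cast_le.2 ?_)
      omega
    have hle : √((1 - (S : ℝ) / m) / ((S : ℝ) / m * S)) ≤ √(m : ℝ) / S := by
      rw [Real.sqrt_le_left (by positivity), div_pow, Real.sq_sqrt hm0.le, div_le_div_iff₀
        (by positivity) (by positivity)]
      have h1 : 1 - (S : ℝ) / m ≤ 1 := sub_le_self _ (by positivity)
      have h2 : (m : ℝ) * ((S : ℝ) / m * S) = S ^ 2 := by field_simp
      rw [h2]
      exact mul_le_of_le_one_left (by positivity) h1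
    rw [div_le_iff₀ hLm] at hceil
    calc _ ≤ Lpm * (√(m : ℝ) / S) := by gcongr
      _ = Lpm * √(m : ℝ) / S := by ring
      _ ≤ Lm := by
        rw [div_le_iff₀ hS0]
        linarith
  · have : S = m := by omega
    rw [this, div_self hm0.ne']
    simpa using hLm.le

/-- The step-size condition for γ = (a + b)⁻¹; clearing denominators leaves ab ≥ 0. -/
theorem inv_mul_add_inv_sq_mul_le {a b : ℝ} (ha : 0 < a) (hb : 0 ≤ b) :
    (a + b)⁻¹ * a + (a + b)⁻¹ ^ 2 * b ^ 2 ≤ 1 := by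
  have h : 0 < a + b := by positivity
  rw [inv_pow, inv_mul_eq_div, inv_mul_eq_div, div_add_div _ _ h.ne' (by positivity),
    div_le_one (by positivity)]
  nlinarith [mul_nonneg h.le (mul_nonneg ha.le hb)]

end Parameters

end FreyaPAGE

/-! ### The theorem -/

open FreyaPAGE
theorem mainTheorem8 :
    ∃ c C : ℝ≥0, 0 < c ∧
      ∀ (n m d : ℕ) [NeZero n] [NeZero m] (f : Fin m → EuclideanSpace ℝ (Fin d) → ℝ)
        (Lm Lp Lpm fstar ε : ℝ) (τ : Fin n → ℝ≥0∞) (x0 : EuclideanSpace ℝ (Fin d)),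
        (∀ i, Differentiable ℝ (f i)) →
        0 < Lm → IsSmoothWith Lm (objective f) → (∀ x, fstar ≤ objective f x) →
        0 ≤ Lp → MeanSquaredSmooth Lp f →
        0 ≤ Lpm → HessianVariance Lpm f →
        (n : ℝ) * Real.log n ≤ m →
        Monotone τ →
        0 < ε →
        ∀ (δ γ : ℝ) (S K : ℕ) (p : ℝ≥0) (hp : p ≤ 1) (hK : 0 < K),
        δ = objective f x0 - fstar →
        S = min (max ⌈Lpm * √(m : ℝ) / Lm⌉₊ 1) m →
        p = (S : ℝ≥0) / (m : ℝ≥0) →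
        γ = (Lm + Lpm * √((1 - (p : ℝ)) / ((p : ℝ) * S)))⁻¹ →
        -- `K` is the least positive integer with `K ≥ K_PAGE`
        K = max ⌈2 * δ / ε * (Lm + Lpm * √((1 - (p : ℝ)) / ((p : ℝ) * S)))⌉₊ 1 →
        -- for all computation times within the bounds `τ`, the method finds an `ε`-stationary
        -- point, in expected time `O(t*(m) + (δ⁰ L₋ / ε) t*(S))`
        (∀ T : ComputeTimes (EuclideanSpace ℝ (Fin d)) n m, T.BoundedBy τ →
          expect (freyaPAGE f T γ S p hp x0 K hK)
              (fun r => ENNReal.ofReal (‖gradient (objective f) r.1‖ ^ 2)) ≤ ENNReal.ofReal ε ∧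
          expect (freyaPAGE f T γ S p hp x0 K hK) (fun r => r.2) ≤
            C * (equilibriumTime m τ + ENNReal.ofReal (δ * Lm / ε) * equilibriumTime S τ)) ∧
        -- if every gradient takes worker `i` exactly `τ i` seconds, the expected time is
        -- also `Ω(t*(m) + (δ⁰ L₋ / ε) t*(S))`
        c * (equilibriumTime m τ + ENNReal.ofReal (δ * Lm / ε) * equilibriumTime S τ) ≤
          expect (freyaPAGE f (ComputeTimes.exact (EuclideanSpace ℝ (Fin d)) m τ)
            γ S p hp x0 K hK) (fun r => r.2) := by
  -- The upper bound is 18 t*(m) + 20 K t*(S) with K ≤ 4R + 1, which gives 80 for the R term and 18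
  -- + 20 ≤ 80 for the other, by t*(S) ≤ t*(m). The lower bound has 1/2 per call and K ≥ R.
  refine ⟨2⁻¹, 80, by norm_num, ?_⟩
  intro n m d _ _ f Lm Lp Lpm fstar ε τ x0 hf hLm hsmooth hmin _ _ hLpm hvar hnm hτ hε δ γ S K p hp
    hK hδ hS hpS hγ hKdef
  have hm : 0 < m := NeZero.pos m
  have hm0 : (0 : ℝ) < m := Nat.cast_pos.2 hm
  have hS1 : 0 < S := by omega
  have hSm : S ≤ m := by omega
  have hS0 : (0 : ℝ) < S := Nat.cast_pos.2 hS1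
  have hpR : (p : ℝ) = (S : ℝ) / m := by rw [hpS]; simp
  have hp0 : 0 < p := by
    rw [← NNReal.coe_pos, hpR]
    positivity
  have hp0' : (0 : ℝ) < p := hp0
  have hp1 : (0 : ℝ) ≤ 1 - p := sub_nonneg.2 (by exact_mod_cast hp)
  have hδ0 : 0 ≤ δ := by
    rw [hδ]
    exact sub_nonneg.2 (hmin x0)
  have hb := mul_sqrt_le hm hLm hLpm hS
  rw [← hpR] at hb
  set b := Lpm * √((1 - (p : ℝ)) / ((p : ℝ) * S)) with hbdef
  have hb0 : 0 ≤ b := by positivity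
  have hab : 0 < Lm + b := by positivity
  have hγ0 : 0 < γ := by
    rw [hγ]
    positivity
  have hγL : γ * Lm + γ ^ 2 * ((1 - p) / p * (Lpm ^ 2 / S)) ≤ 1 := by
    have h1 : (1 - (p : ℝ)) / p * (Lpm ^ 2 / S) = b ^ 2 := by
      rw [hbdef, mul_pow, Real.sq_sqrt (by positivity)]
      field_simp
    rw [h1, hγ]
    exact inv_mul_add_inv_sq_mul_le hLm hb0
  have hK0 : (0 : ℝ) < K := Nat.cast_pos.2 hK
  have hKge : 2 * δ / ε * (Lm + b) ≤ K := by
    refine (Nat.le_ceil _).trans (Nat.cast_le.2 ?_)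
    omega
  have hKle : (K : ℝ) ≤ 4 * (δ * Lm / ε) + 1 := by
    have h1 : (K : ℝ) ≤ 2 * δ / ε * (Lm + b) + 1 := by
      have h0 : 0 ≤ 2 * δ / ε * (Lm + b) := by positivity
      rw [hKdef, Nat.cast_max]
      refine max_le (Nat.ceil_lt_add_one h0).le ?_
      rw [Nat.cast_one]
      linarith
    have h2 : 2 * δ / ε * (Lm + b) ≤ 2 * δ / ε * (2 * Lm) := by
      gcongr
      linarith
    have h3 : 2 * δ / ε * (2 * Lm) = 4 * (δ * Lm / ε) := by ring
    linarith
  have hR0 : 0 ≤ δ * Lm / ε := by positivity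
  refine ⟨fun T hT => ⟨?_, ?_⟩, ?_⟩
  · refine (expect_freyaPAGE_norm_gradient_sq_le hf hsmooth hmin hvar T hγ0 hS1 hp hp0 hγL x0 K
      hK).trans (ENNReal.ofReal_le_ofReal ?_)
    rw [← hδ, hγ, div_mul_eq_mul_div, div_le_iff₀ (by positivity), inv_mul_eq_div,
      mul_div_assoc', le_div_iff₀ hab]
    rw [div_mul_eq_mul_div, div_le_iff₀ hε] at hKge
    linarith
  · rw [expect_freyaPAGE_time]
    refine (expect_run_time_le f hnm hT γ hS1 hSm hp hpS x0 K).trans ?_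
    have hKE : (K : ℝ≥0∞) ≤ 4 * ENNReal.ofReal (δ * Lm / ε) + 1 := by
      have := ENNReal.ofReal_le_ofReal hKle
      rwa [ENNReal.ofReal_natCast, ENNReal.ofReal_add (by positivity) zero_le_one,
        ENNReal.ofReal_mul (by norm_num), ENNReal.ofReal_one, ENNReal.ofReal_ofNat] at this
    calc _ ≤ 18 * equilibriumTime m τ + (4 * ENNReal.ofReal (δ * Lm / ε) + 1) *
          (20 * equilibriumTime S τ) := by gcongr
      _ = 18 * equilibriumTime m τ + 20 * equilibriumTime S τ +
          80 * (ENNReal.ofReal (δ * Lm / ε) * equilibriumTime S τ) := by ring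
      _ ≤ 18 * equilibriumTime m τ + 20 * equilibriumTime m τ +
          80 * (ENNReal.ofReal (δ * Lm / ε) * equilibriumTime S τ) := by
        gcongr
        exact equilibriumTime_mono hSm τ
      _ ≤ 80 * equilibriumTime m τ +
          80 * (ENNReal.ofReal (δ * Lm / ε) * equilibriumTime S τ) := by
        rw [← add_mul]
        gcongr
        norm_num
      _ = _ := by
        rw [← mul_add]
        norm_num
  · rw [expect_freyaPAGE_time]
    refine le_trans ?_ (le_expect_run_time f hτ γ hS1 hSm hp x0 K)
    have hKE : ENNReal.ofReal (δ * Lm / ε) ≤ K := by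
      rw [← ENNReal.ofReal_natCast]
      refine ENNReal.ofReal_le_ofReal (le_trans ?_ hKge)
      have h1 : 2 * δ / ε * (Lm + b) = 2 * (δ * Lm / ε) + 2 * δ / ε * b := by ring
      have h2 : 0 ≤ 2 * δ / ε * b := by positivity
      linarith
    rw [ENNReal.coe_inv two_ne_zero, ENNReal.coe_ofNat, mul_add, mul_left_comm]
    gcongr
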